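/- Let $\beta>1$ be a real number, $N\in\mathbb N$ with $N-1<\beta\le N$, $\Sigma=\{0,\dots,N-1\}$. **The shift.** For $x\in[0,1)$ let $d(x)=(d_n(x))_{n\ge1}$, $d_n(x)=[\beta f_\beta^{\,n-1}(x)]$, $f_\beta(x)=\beta x-[\beta x]$. Let $\xi_\beta=(\xi_n)_{n\ge 1}$ be the supremum of all $d(x)$, $x\in[0,1)$, in the lexicographical order, and let $X_\beta=\{\omega\in\Sigma^{\mathbb N}: \sigma^m\omega\le\xi_\beta \text{ for all } m\ge0\}$, where $\sigma$ is the shift. Assume that $X_\beta$ is sofic, that is, $X_\beta$ is the set of label sequences of right-infinite paths in a finite labelled directed graph (equivalently, the $\beta$-expansion $d(1,\beta)$ of $1$ is ultimately periodic, finite expansions included). Let $B_*(X_\beta)$ be the set of words that appear in elements of $X_\beta$. **The group $\Gamma_\beta$.** Two points $x,y\in X_\beta$ are $l$-past equivalent if, for every word $\mu$ with $|\mu|\le l$, $\mu x\in X_\beta$ iff $\mu y\in X_\beta$; let $\Omega_\beta$ be the projective limit over $l$ of the finite sets of $l$-past equivalence classes. A word $\mu$ is in the past of $u\in\Omega_\beta$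 if $\mu x\in X_\beta$ for the points $x$ of the class of $u$ at level $|\mu|$. There is an edge labelled $\alpha\in\Sigma$ from $u$ to $v$ if $\alpha$ is in the past of $v$ and, for all words $\mu$, $\mu$ is in the past of $u$ iff $\mu\alpha$ is in the past of $v$. Let $G_\beta^{(0)}$ be the space of right-infinite labelled paths $z=(\alpha_n,u_{n-1})_{n\ge1}$, with $\alpha_n$ labelling an edge from $u_{n-1}$ to $u_n$, in the product topology; let $\sigma_\beta$ delete the first edge, and put $G_\beta=\{(x,k-l,y): k,l\ge 0,\ \sigma_\beta^k(x)=\sigma_\beta^l(y)\}$, with range $x$, source $y$ and the topology generated by the sets $\{(x,k-l,y):x\in A,\ y\in B,\ \sigma_\beta^k(x)=\sigma_\beta^l(y)\}$, $A,B$ open. $\Gamma_\beta=[[G_\beta]]$ is the group of homeomorphisms of $G^{(0)}_\beta$ of the form $r\circ(s|_U)^{-1}$, where $U\subset G_\beta$ is compact open, $r$ and $s$ are injective on $U$ and $r(U)=s(U)=G_\beta^{(0)}$. **The minimal projections.** For a word $\mu$ let $a_\mu\in C(G_\beta^{(0)})$ be the indicator function of the set of paths with $\mu$ in the past of $u_0$,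 and let $\mathcal A_\beta$ be the $C^*$-subalgebra of $C(G_\beta^{(0)})$ generated by the $a_\mu$, $\mu\in B_*(X_\beta)$. In the sofic case it is finite dimensional, and each of its minimal projections has the form $E=a_{\xi_1\cdots\xi_p}-a_{\xi_1\cdots\xi_q}$, or $E=a_{\xi_1\cdots\xi_p}$ for the smallest of the projections $a_{\xi_1\cdots\xi_n}$ (then put $\beta_q:=0$ below). Put $\beta_n=\beta^n-\xi_1\beta^{n-1}-\dots-\xi_n$. **$\beta$-adic PL functions.** For $\nu=(\nu_1,\dots,\nu_n)\in B_*(X_\beta)$ and a minimal projection $E$ of $\mathcal A_\beta$ as above with $a_\nu\ge E$, put $l(\nu_{[E]})=\sum_{i=1}^n\nu_i\beta^{-i}+\beta^{-n}\beta_q$ and $r(\nu_{[E]})=\sum_{i=1}^n\nu_i\beta^{-i}+\beta^{-n}\beta_p$; the interval $[l(\nu_{[E]}),r(\nu_{[E]}))$ is called a $\beta$-adic interval for $\nu_{[E]}$. A rectangle $I\times J$ is $\beta$-adic if $I$ and $J$ are $\beta$-adic intervals for $\nu_{[E]}$ and $\mu_{[E]}$, for some words $\nu,\mu$ and the same $E$,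 and the ratio of the length of $J$ to that of $I$ is $\beta^{|\nu|-|\mu|}$. A bijection $f$ of $[0,1)$ is a $\beta$-adic PL function if there are partitions $0=x_0<\dots<x_m=1$, $0=y_0<\dots<y_m=1$ and a permutation $\pi$ of $\{1,\dots,m\}$ such that every $[x_{p-1},x_p)\times[y_{\pi(p)-1},y_{\pi(p)})$ is a $\beta$-adic rectangle and $f$ is, on $[x_{p-1},x_p)$, the increasing affine map onto $[y_{\pi(p)-1},y_{\pi(p)})$. **Theorem.** The $\beta$-adic PL functions form a group under composition, and $\Gamma_\beta$ is realized as this group: there is a group isomorphism $\tau\mapsto f_\tau$ from $\Gamma_\beta$ onto the group of all $\beta$-adic PL functions such that, with $\kappa(z)=\sum_{n\ge1}\alpha_n\beta^{-n}$ for $z=(\alpha_n,u_{n-1})_{n\ge1}\in G_\beta^{(0)}$, for every $\tau\in\Gamma_\beta$ all but finitely many $z\in G_\beta^{(0)}$ satisfy $\kappa(z)\in[0,1)$ and $\kappa(\tau(z))=f_\tau(\kappa(z))$. -/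

import Mathlib

namespace BetaPL

noncomputable section

/-! ### Expansions, the maximal sequence and the shift space

Sequences are indexed from `0`, so the entry `n` is the digit number `n + 1`. -/

/-- The transformation `x ↦ β x - [β x]`. -/
def betaMap (β x : ℝ) : ℝ := β * x - ⌊β * x⌋

/-- The digits of the `β`-expansion of a point `x` of `[0,1)`. -/
def digits (β x : ℝ) (n : ℕ) : ℕ := ⌊β * (betaMap β)^[n] x⌋₊

/-- The sequence `ξ_β`: the supremum of all expansions of points of `[0,1)` in the lexicographical
order. It exists for `1 < β`, see `xi_isLUB`. -/
def xi (β : ℝ) : ℕ → ℕ :=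
  Classical.epsilon fun ξ : ℕ → ℕ =>
    IsLUB ((fun x : ℝ => toLex (digits β x)) '' Set.Ico 0 1) (toLex ξ)

/-- Remainders of the quasi-greedy expansion of `1`; used only to prove that `xi` exists. -/
def qgRem (β : ℝ) : ℕ → ℝ
  | 0 => 1
  | n + 1 => β * qgRem β n - (⌈β * qgRem β n⌉ - 1)

lemma qgRem_mem {β : ℝ} (n : ℕ) : 0 < qgRem β n ∧ qgRem β n ≤ 1 := by
  cases n with
  | zero => simp [qgRem]
  | succ n =>
    have h1 := Int.ceil_lt_add_one (β * qgRem β n)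
    have h2 := Int.le_ceil (β * qgRem β n)
    simp only [qgRem]
    constructor <;> linarith

/-- Digits of the quasi-greedy expansion of `1`; used only to prove that `xi` exists. -/
def qgDigit (β : ℝ) (n : ℕ) : ℕ := (⌈β * qgRem β n⌉ - 1).toNat

lemma qgDigit_cast {β : ℝ} (hβ : 1 < β) (n : ℕ) :
    (qgDigit β n : ℤ) = ⌈β * qgRem β n⌉ - 1 := by
  have h : 0 < ⌈β * qgRem β n⌉ := Int.ceil_pos.2 (mul_pos (by linarith) (qgRem_mem n).1)
  rw [qgDigit, Int.toNat_of_nonneg]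
  omega

lemma qgRem_succ {β : ℝ} (hβ : 1 < β) (n : ℕ) :
    qgRem β (n + 1) = β * qgRem β n - qgDigit β n := by
  have h : ((qgDigit β n : ℤ) : ℝ) = ((⌈β * qgRem β n⌉ - 1 : ℤ) : ℝ) := by rw [qgDigit_cast hβ n]
  push_cast at h
  rw [h, qgRem]

lemma iter_nonneg {β : ℝ} {x : ℝ} (hx : 0 ≤ x) (n : ℕ) :
    0 ≤ (betaMap β)^[n] x := by
  cases n with
  | zero => simpa using hx
  | succ n =>
    rw [Function.iterate_succ_apply']
    exact sub_nonneg.2 (Int.floor_le _)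

lemma iter_succ {β : ℝ} (hβ : 1 < β) {x : ℝ} (hx : 0 ≤ x) (n : ℕ) :
    (betaMap β)^[n + 1] x = β * (betaMap β)^[n] x - digits β x n := by
  rw [Function.iterate_succ_apply', betaMap, digits]
  have h : 0 ≤ β * (betaMap β)^[n] x := mul_nonneg (by linarith) (iter_nonneg hx n)
  rw [natCast_floor_eq_intCast_floor h]

lemma iter_lt_qgRem {β : ℝ} (hβ : 1 < β) {x : ℝ} (hx : 0 ≤ x) (hx1 : x < 1) (n : ℕ)
    (h : ∀ i < n, digits β x i = qgDigit β i) : (betaMap β)^[n] x < qgRem β n := by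
  induction n with
  | zero => simpa [qgRem] using hx1
  | succ n ih =>
    have := ih fun i hi => h i (by omega)
    rw [iter_succ hβ hx, qgRem_succ hβ, h n (by omega)]
    have := mul_lt_mul_of_pos_left this (by linarith : (0 : ℝ) < β)
    linarith

lemma exists_prefix {β : ℝ} (hβ : 1 < β) (n : ℕ) :
    ∃ x ∈ Set.Ico (0 : ℝ) 1, ∀ i < n, digits β x i = qgDigit β i := by
  have hb : (0 : ℝ) < β := by linarith
  have key : ∀ k ≤ n, ∃ y : ℝ, 0 ≤ y ∧ y < qgRem β (n - k) ∧
      ∀ i < k, digits β y i = qgDigit β (n - k + i) := by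
    intro k
    induction k with
    | zero => exact fun _ => ⟨0, le_rfl, (qgRem_mem _).1, by simp⟩
    | succ k ih =>
      intro hk
      obtain ⟨y, hy0, hy1, hy⟩ := ih (by omega)
      have e : n - k = n - (k + 1) + 1 := by omega
      set j := n - (k + 1) with hj
      rw [e] at hy1 hy
      have hr := (qgRem_mem (β := β) (j + 1)).2
      have hz : β * ((y + qgDigit β j) / β) = y + qgDigit β j := by field_simp
      have hfl : ⌊y + (qgDigit β j : ℝ)⌋ = (qgDigit β j : ℤ) := by
        rw [Int.floor_eq_iff]
        push_cast
        constructor <;> linarith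
      have hm : betaMap β ((y + qgDigit β j) / β) = y := by
        rw [betaMap, hz, hfl]
        push_cast
        ring
      refine ⟨(y + qgDigit β j) / β, by positivity, ?_, ?_⟩
      · rw [div_lt_iff₀ hb]
        rw [qgRem_succ hβ] at hy1
        linarith
      · intro i hi
        cases i with
        | zero =>
          simp only [digits, Function.iterate_zero, id_eq, add_zero]
          rw [hz]
          have : (⌊y + (qgDigit β j : ℝ)⌋₊ : ℤ) = qgDigit β j := by
            rw [Int.natCast_floor_eq_floor (by positivity), hfl]
          exact_mod_cast this
        | succ i =>
          have := hy i (by omega)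
          rw [digits, Function.iterate_succ_apply, hm]
          rw [digits] at this
          rw [this]
          congr 1
          omega
  obtain ⟨y, h0, h1, h⟩ := key n le_rfl
  refine ⟨y, ⟨h0, ?_⟩, fun i hi => ?_⟩
  · simpa [qgRem] using h1
  · simpa using h i hi

lemma qgDigit_isLUB {β : ℝ} (hβ : 1 < β) :
    IsLUB ((fun x : ℝ => toLex (digits β x)) '' Set.Ico 0 1) (toLex (qgDigit β)) := by
  constructor
  · rintro _ ⟨x, ⟨hx0, hx1⟩, rfl⟩
    by_contra hlt
    obtain ⟨n, hn, hlt⟩ := not_le.1 hlt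
    have h := iter_lt_qgRem hβ hx0 hx1 n fun i hi => (hn i hi).symm
    have h2 : (digits β x n : ℤ) ≤ qgDigit β n := by
      rw [qgDigit_cast hβ, digits, Int.natCast_floor_eq_floor
        (mul_nonneg (by linarith) (iter_nonneg hx0 n))]
      have : ⌊β * (betaMap β)^[n] x⌋ < ⌈β * qgRem β n⌉ := by
        have h3 := Int.floor_le (β * (betaMap β)^[n] x)
        have h4 := Int.le_ceil (β * qgRem β n)
        have h5 := mul_lt_mul_of_pos_left h (by linarith : (0 : ℝ) < β)
        exact_mod_cast (h3.trans_lt h5).trans_le h4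
      omega
    have h3 : qgDigit β n < digits β x n := hlt
    omega
  · intro b hb
    by_contra hlt
    obtain ⟨n, hn, hlt⟩ := not_le.1 hlt
    obtain ⟨x, hx, h⟩ := exists_prefix hβ (n + 1)
    refine absurd (hb ⟨x, hx, rfl⟩) (not_le.2 ⟨n, fun i hi => ?_, ?_⟩)
    · exact (hn i hi).trans (h i (by omega)).symm
    · exact lt_of_lt_of_eq hlt (h n (by omega)).symm

theorem xi_isLUB {β : ℝ} (hβ : 1 < β) :
    IsLUB ((fun x : ℝ => toLex (digits β x)) '' Set.Ico 0 1) (toLex (xi β)) :=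
  Classical.epsilon_spec (p := fun ξ : ℕ → ℕ =>
    IsLUB ((fun x : ℝ => toLex (digits β x)) '' Set.Ico 0 1) (toLex ξ)) ⟨qgDigit β, qgDigit_isLUB hβ⟩

/-- The one-sided shift space `X_β` over the alphabet `{0, …, N - 1}`, `N - 1 < β ≤ N`. -/
def betaShift (β : ℝ) : Set (ℕ → ℕ) :=
  {ω | (∀ n, ω n < ⌈β⌉₊) ∧ ∀ m, toLex (fun n => ω (m + n)) ≤ toLex (xi β)}

/-- A one-sided shift space is sofic if it consists of the label sequences of the right-infinite
paths in a finite labelled directed graph. -/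
def IsSofic (X : Set (ℕ → ℕ)) : Prop :=
  ∃ (k : ℕ) (E : Finset (Fin k × ℕ × Fin k)),
    X = {x | ∃ v : ℕ → Fin k, ∀ n, (v n, x n, v (n + 1)) ∈ E}

/-- Admissible words: the words that appear in some element of `X_β`. -/
def admissible (β : ℝ) : Set (List ℕ) :=
  {μ | ∃ x ∈ betaShift β, ∃ m, ∀ (i : ℕ) (h : i < μ.length), x (m + i) = μ[i]}

/-- The concatenation of a word and a sequence. -/
def cat (μ : List ℕ) (x : ℕ → ℕ) : ℕ → ℕ := fun n => μ.getD n (x (n - μ.length))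

/-! ### The unit space of the groupoid

The groupoid of the `β`-shift is the one attached to the canonical `λ`-graph system of `X_β`. Two
points of `X_β` are `l`-past equivalent if the same words of length at most `l` may be put in front
of them; the vertices at level `l` are the `l`-past equivalence classes. The projective limit of
these finite sets is the space of all `u` as in `IsVertex`, with `u μ = true` meaning that `μ` may
be put in front. -/

/-- `u` is a point of the projective limit of the sets of `l`-past equivalence classes. -/
def IsVertex (β : ℝ) (u : List ℕ → Bool) : Prop :=
  ∀ l : ℕ, ∃ x ∈ betaShift β, ∀ μ : List ℕ, μ.length ≤ l → (u μ = true ↔ cat μ x ∈ betaShift β)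

/-- The edge labelled `a` from `u` to `v`: if `v` is the past of `x`, then `a x` lies in `X_β` and
`u` is the past of `a x`. -/
def IsEdge (u : List ℕ → Bool) (a : ℕ) (v : List ℕ → Bool) : Prop :=
  v [a] = true ∧ ∀ μ : List ℕ, u μ = v (μ ++ [a])

/-- The unit space of the groupoid: right-infinite labelled paths, with the topology of the product
of discrete spaces. A path is given by its labels `z.1.1` and by its vertices `z.1.2`; the first
vertex is determined by the second one and the first label. -/
def UnitSpace (β : ℝ) : Type :=
  {z : (ℕ → ℕ) × (ℕ → List ℕ → Bool) //
    (∀ n, IsVertex β (z.2 n)) ∧ ∀ n, IsEdge (z.2 n) (z.1 n) (z.2 (n + 1))}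

instance (β : ℝ) : TopologicalSpace (UnitSpace β) := instTopologicalSpaceSubtype

/-- The map `σ_β` on the unit space: drop the first edge of a path. -/
def shiftMap (β : ℝ) (z : UnitSpace β) : UnitSpace β :=
  ⟨(fun n => z.1.1 (n + 1), fun n => z.1.2 (n + 1)),
    fun n => z.2.1 (n + 1), fun n => z.2.2 (n + 1)⟩

/-- The point of `[0,1]` whose expansion is the label sequence of a path. -/
def coding {β : ℝ} (z : UnitSpace β) : ℝ := ∑' n, (z.1.1 n : ℝ) / β ^ (n + 1)

/-! ### The groupoid of a map and its topological full group -/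

/-- The groupoid of triples `(x, k - l, y)` with `s^k x = s^l y`; its range map is `x` and its
source map is `y`. -/
def DRGroupoid {X : Type} (s : X → X) : Type :=
  {g : X × ℤ × X // ∃ k l : ℕ, g.2.1 = (k : ℤ) - l ∧ s^[k] g.1 = s^[l] g.2.2}

namespace DRGroupoid

variable {X : Type} {s : X → X}

def range (g : DRGroupoid s) : X := g.1.1

def source (g : DRGroupoid s) : X := g.1.2.2

/-- The set of all `(x, k - l, y)` with `x ∈ A`, `y ∈ B` and `s^k x = s^l y`. -/
def basic (s : X → X) (A : Set X) (k l : ℕ) (B : Set X) : Set (DRGroupoid s) :=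
  {g | g.range ∈ A ∧ g.source ∈ B ∧ g.1.2.1 = (k : ℤ) - l ∧ s^[k] g.range = s^[l] g.source}

instance [TopologicalSpace X] : TopologicalSpace (DRGroupoid s) :=
  TopologicalSpace.generateFrom
    {W | ∃ (A B : Set X) (k l : ℕ), IsOpen A ∧ IsOpen B ∧ W = basic s A k l B}

end DRGroupoid

/-- The homeomorphisms of the unit space of the form `r ∘ (s|_U)⁻¹`, with `U` a compact open
`G`-set. -/
def topologicalFullGroup {X : Type} [TopologicalSpace X] (s : X → X) : Set (X ≃ₜ X) :=
  {α | ∃ U : Set (DRGroupoid s), IsCompact U ∧ IsOpen U ∧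
    Set.InjOn DRGroupoid.range U ∧ Set.InjOn DRGroupoid.source U ∧
    DRGroupoid.range '' U = Set.univ ∧ DRGroupoid.source '' U = Set.univ ∧
    ∀ g ∈ U, α g.source = g.range}

/-! ### The algebra `A_β` and its minimal projections

The diagonal algebra `D_β` is the `C^*`-algebra of continuous functions on the unit space, with the
supremum norm; as the unit space is compact, all of them are bounded. -/

/-- The projection `a_μ = S_μ^* S_μ`, the indicator of the set of the paths in front of which `μ`
may be put. -/
def proj (β : ℝ) (μ : List ℕ) : BoundedContinuousFunction (UnitSpace β) ℂ :=
  BoundedContinuousFunction.ofNormedAddCommGroup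
    (fun z : UnitSpace β => bif z.1.2 0 μ then (1 : ℂ) else 0)
    (by
      have h : Continuous fun z : UnitSpace β => z.1.2 0 μ :=
        (continuous_apply μ).comp ((continuous_apply 0).comp
          (continuous_snd.comp continuous_subtype_val))
      exact (continuous_of_discreteTopology
        (f := fun b : Bool => (bif b then 1 else 0 : ℂ))).comp h)
    1
    (by
      intro z
      cases z.1.2 0 μ <;> simp)

/-- The `C^*`-subalgebra `A_β` of `D_β` generated by the projections `a_μ`. -/
def algebraA (β : ℝ) : StarSubalgebra ℂ (BoundedContinuousFunction (UnitSpace β) ℂ) :=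
  (StarAlgebra.adjoin ℂ (proj β '' admissible β)).topologicalClosure

/-- The minimal projections of `A_β`. -/
def IsMinimalProjection (β : ℝ) (E : BoundedContinuousFunction (UnitSpace β) ℂ) : Prop :=
  E ∈ algebraA β ∧ IsStarProjection E ∧ E ≠ 0 ∧
    ∀ F ∈ algebraA β, IsStarProjection F → F * E = F → F = 0 ∨ F = E

/-- The set `Γ_*^-(E)` of the admissible words `ν` with `S_ν^* S_ν ≥ E`. -/
def wordsAbove (β : ℝ) (E : BoundedContinuousFunction (UnitSpace β) ℂ) : Set (List ℕ) :=
  {ν | ν ∈ admissible β ∧ proj β ν * E = E}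

/-! ### Intervals, rectangles, patterns of squares and PL functions -/

/-- The prefix of length `n` of `ξ_β`. -/
def xiWord (β : ℝ) (n : ℕ) : List ℕ := List.ofFn fun i : Fin n => xi β i

/-- `β_n = β^n - ξ_1 β^(n-1) - ⋯ - ξ_n`, the value of the KMS state at the projection of the prefix
of length `n` of `ξ_β`. -/
def betaVal (β : ℝ) (n : ℕ) : ℝ := β ^ n - ∑ i ∈ Finset.range n, (xi β i : ℝ) * β ^ (n - 1 - i)

/-- `l(ν) = ν_1 / β + ⋯ + ν_n / β^n`. -/
def leftEnd (β : ℝ) (ν : List ℕ) : ℝ := ∑ i : Fin ν.length, (ν[i] : ℝ) / β ^ ((i : ℕ) + 1)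

/-- `[c, d)` is the `β`-adic interval of the word `ν` decorated by the minimal projection `E`. With
`E = a_p - a_q`, where `a_n` is the projection of the prefix of length `n` of `ξ_β`, its end points
are `c = l(ν) + β_q / β^n` and `d = l(ν) + β_p / β^n`, `n` the length of `ν`. The smallest of the
projections `a_n` is itself minimal: there the subtracted term is `0` and `c = l(ν)`. -/
def IsInterval (β : ℝ) (ν : List ℕ) (E : BoundedContinuousFunction (UnitSpace β) ℂ)
    (c d : ℝ) : Prop :=
  IsMinimalProjection β E ∧ ν ∈ wordsAbove β E ∧
    ∃ p : ℕ, d = leftEnd β ν + betaVal β p / β ^ ν.length ∧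
      ((∃ q : ℕ, E = proj β (xiWord β p) - proj β (xiWord β q) ∧
          c = leftEnd β ν + betaVal β q / β ^ ν.length) ∨
        (E = proj β (xiWord β p) ∧ c = leftEnd β ν))

/-- `[c, d) × [c', d')` is a `β`-adic rectangle. -/
def IsRectangle (β c d c' d' : ℝ) : Prop :=
  ∃ (ν μ : List ℕ) (E : BoundedContinuousFunction (UnitSpace β) ℂ),
    IsInterval β ν E c d ∧ IsInterval β μ E c' d' ∧
      (d' - c') / (d - c) = β ^ ((ν.length : ℤ) - μ.length)

/-- `0 = x_0 < x_1 < ⋯ < x_m = 1`. -/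
def IsPartition {m : ℕ} (x : Fin (m + 1) → ℝ) : Prop :=
  StrictMono x ∧ x 0 = 0 ∧ x (Fin.last m) = 1

/-- Two partitions and a permutation that form a `β`-adic pattern of squares. -/
def IsPattern (β : ℝ) {m : ℕ} (x y : Fin (m + 1) → ℝ) (π : Equiv.Perm (Fin m)) : Prop :=
  IsPartition x ∧ IsPartition y ∧
    ∀ p : Fin m, IsRectangle β (x p.castSucc) (x p.succ) (y (π p).castSucc) (y (π p).succ)

/-- The `β`-adic PL functions: bijections `f` of `[0,1)` that map each interval `[x_(p-1), x_p)` of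
a `β`-adic pattern of squares affinely and increasingly onto `[y_(π(p)-1), y_π(p))`. Right
continuity and the left limit `y_π(p)` at `x_p` are consequences of the formula. -/
def IsBetaAdicPL (β : ℝ) (f : Equiv.Perm (Set.Ico (0 : ℝ) 1)) : Prop :=
  ∃ (m : ℕ) (x y : Fin (m + 1) → ℝ) (π : Equiv.Perm (Fin m)), IsPattern β x y π ∧
    ∀ (p : Fin m) (t : Set.Ico (0 : ℝ) 1), x p.castSucc ≤ (t : ℝ) → (t : ℝ) < x p.succ →
      (f t : ℝ) = y (π p).castSucc +
        (y (π p).succ - y (π p).castSucc) / (x p.succ - x p.castSucc) * ((t : ℝ) - x p.castSucc)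

end

end BetaPL

namespace BetaPL

noncomputable section

/-! ### Weights of words -/

/-! A word μ restricts what may follow it only through its weight: up to the right end point, the t
in [0,1) whose expansion may follow μ fill [0, `weight β 1 μ`). The positive weights are exactly the
numbers β_n (`weight_mem_remSet`, `weight_xiWord`), and for a sofic shift there are only finitely
many of them (`remSet_finite`). A vertex therefore amounts to one number ρ among the β_n: its past
consists of the words of weight at least ρ, and it stands for the interval [low ρ, ρ) between
consecutive values. The indicators of the paths starting at a given vertex are the minimal
projections.

An edge labelled a from ρ to ρ' sends [low ρ', ρ') into [low ρ, ρ) by t ↦ (a + t)/β. Hence the paths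
with n prescribed edges ending at ρ correspond to a β-adic interval (`agree_lift_iff`), and a β-adic
rectangle is a pair of cylinders with the same terminal vertex (`isRectangle_iff`). By compactness,
an element of the full group replaces finitely many initial segments by others that end at the same
vertices (`exists_uniform_orbital`); on values this is affine (`coding_eq_affine`).

A cylinder end point can be the value of several paths, so the passage to [0,1) uses the paths that
are limits from the right. They are in bijection with [0,1) through `lift`, they are dense, and
being one of them is a property of the tail, so the full group permutes them (`isRight_apply_iff`).
This gives a faithful action `realize`, whose image is the set of PL functions by
`isBetaAdicPL_realize` and `exists_realize_eq`. For a given element, at most one path in each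
cylinder of a fixed length violates the formula for values, namely one sitting at the right end
(`exceptional_finite`). -/

lemma xi_eq_qgDigit {β : ℝ} (hβ : 1 < β) : xi β = qgDigit β :=
  toLex.injective ((xi_isLUB hβ).unique (qgDigit_isLUB hβ))

/-- The values `β_n`. -/
def remSet (β : ℝ) : Set ℝ := Set.range (qgRem β)

lemma one_mem_remSet (β : ℝ) : (1 : ℝ) ∈ remSet β := ⟨0, rfl⟩

lemma remSet_pos {β r : ℝ} (h : r ∈ remSet β) : 0 < r := by
  obtain ⟨n, rfl⟩ := h; exact (qgRem_mem n).1

lemma remSet_le_one {β r : ℝ} (h : r ∈ remSet β) : r ≤ 1 := by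
  obtain ⟨n, rfl⟩ := h; exact (qgRem_mem n).2

/-- `[0, act β s a)` is the set of all `t ∈ [0,1)` with `(a + t) / β < s`. -/
def act (β s : ℝ) (a : ℕ) : ℝ := min 1 (β * s - a)

/-- The iterated action of the letters of a word. -/
def weight (β s : ℝ) (μ : List ℕ) : ℝ := μ.foldl (act β) s

@[simp] lemma weight_nil (β s : ℝ) : weight β s [] = s := rfl

lemma weight_append (β s : ℝ) (μ ν : List ℕ) :
    weight β s (μ ++ ν) = weight β (weight β s μ) ν := List.foldl_append

lemma weight_concat (β s : ℝ) (μ : List ℕ) (a : ℕ) :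
    weight β s (μ ++ [a]) = act β (weight β s μ) a := by
  rw [weight_append]; rfl

lemma act_le_one (β s : ℝ) (a : ℕ) : act β s a ≤ 1 := min_le_left _ _

lemma act_mono {β : ℝ} (hβ : 1 < β) {s t : ℝ} (h : s ≤ t) (a : ℕ) : act β s a ≤ act β t a := by
  have := mul_le_mul_of_nonneg_left h (by linarith : (0 : ℝ) ≤ β)
  exact min_le_min le_rfl (by linarith)

lemma act_nonpos {β : ℝ} (hβ : 1 < β) {s : ℝ} (h : s ≤ 0) (a : ℕ) : act β s a ≤ 0 := by
  have := mul_nonpos_of_nonneg_of_nonpos (by linarith : (0 : ℝ) ≤ β) h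
  have h2 : (0 : ℝ) ≤ a := a.cast_nonneg
  exact (min_le_right _ _).trans (by linarith)

lemma weight_mono {β : ℝ} (hβ : 1 < β) {s t : ℝ} (h : s ≤ t) (μ : List ℕ) :
    weight β s μ ≤ weight β t μ := by
  induction μ using List.reverseRecOn with
  | nil => exact h
  | append_singleton μ a ih => simpa only [weight_concat] using act_mono hβ ih a

lemma weight_nonpos {β : ℝ} (hβ : 1 < β) {s : ℝ} (h : s ≤ 0) (μ : List ℕ) :
    weight β s μ ≤ 0 := by
  induction μ using List.reverseRecOn with
  | nil => exact h
  | append_singleton μ a ih => simpa only [weight_concat] using act_nonpos hβ ih a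

lemma weight_le_one {β s : ℝ} (hs : s ≤ 1) (μ : List ℕ) : weight β s μ ≤ 1 := by
  induction μ using List.reverseRecOn with
  | nil => exact hs
  | append_singleton μ a ih => simpa only [weight_concat] using act_le_one _ _ _

lemma act_qgRem_lt {β : ℝ} (hβ : 1 < β) {k a : ℕ} (h : a < qgDigit β k) :
    act β (qgRem β k) a = 1 := by
  have h1 := qgRem_succ hβ k
  have h2 := (qgRem_mem (β := β) (k + 1)).1
  have h3 : (a : ℝ) + 1 ≤ qgDigit β k := by exact_mod_cast h
  exact min_eq_left (by linarith)

lemma act_qgRem_eq {β : ℝ} (hβ : 1 < β) (k : ℕ) :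
    act β (qgRem β k) (qgDigit β k) = qgRem β (k + 1) := by
  rw [act, ← qgRem_succ hβ]
  exact min_eq_right (qgRem_mem _).2

lemma act_qgRem_gt {β : ℝ} (hβ : 1 < β) {k a : ℕ} (h : qgDigit β k < a) :
    act β (qgRem β k) a ≤ 0 := by
  have h1 := qgRem_succ hβ k
  have h2 := (qgRem_mem (β := β) (k + 1)).2
  have h3 : (qgDigit β k : ℝ) + 1 ≤ a := by exact_mod_cast h
  exact (min_le_right _ _).trans (by linarith)

/-- Against the remainder β_k, a letter below the matching digit of ξ resets the weight to 1, the
digit itself advances to the next remainder, and a larger letter kills the weight. -/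
lemma act_mem_remSet {β : ℝ} (hβ : 1 < β) {r : ℝ} (hr : r ∈ remSet β) {a : ℕ}
    (h : 0 < act β r a) : act β r a ∈ remSet β := by
  obtain ⟨k, rfl⟩ := hr
  rcases lt_trichotomy a (qgDigit β k) with h1 | rfl | h1
  · rw [act_qgRem_lt hβ h1]; exact one_mem_remSet β
  · rw [act_qgRem_eq hβ]; exact ⟨_, rfl⟩
  · exact absurd h (not_lt.2 (act_qgRem_gt hβ h1))

lemma weight_mem_remSet {β : ℝ} (hβ : 1 < β) {r : ℝ} (hr : r ∈ remSet β) {μ : List ℕ}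
    (h : 0 < weight β r μ) : weight β r μ ∈ remSet β := by
  induction μ using List.reverseRecOn with
  | nil => exact hr
  | append_singleton μ a ih =>
    rw [weight_concat] at h ⊢
    exact act_mem_remSet hβ (ih (not_le.1 fun h' => absurd h (not_lt.2 (act_nonpos hβ h' a)))) h

/-- The prefix of length `n` of a sequence. -/
def pre (x : ℕ → ℕ) (n : ℕ) : List ℕ := List.ofFn fun i : Fin n => x i

@[simp] lemma pre_length (x : ℕ → ℕ) (n : ℕ) : (pre x n).length = n := List.length_ofFn

@[simp] lemma pre_zero (x : ℕ → ℕ) : pre x 0 = [] := rfl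

lemma pre_succ (x : ℕ → ℕ) (n : ℕ) : pre x (n + 1) = pre x n ++ [x n] := by
  rw [pre, List.ofFn_succ_last]
  rfl

lemma pre_add (x : ℕ → ℕ) (m n : ℕ) : pre x (m + n) = pre x m ++ pre (fun i => x (m + i)) n := by
  induction n with
  | zero => simp
  | succ n ih => rw [← add_assoc, pre_succ, ih, pre_succ, List.append_assoc]

lemma pre_congr {x y : ℕ → ℕ} {n : ℕ} (h : ∀ i < n, x i = y i) : pre x n = pre y n := by
  unfold pre
  congr 1
  ext i
  exact h i i.2

lemma pre_eq_iff {x y : ℕ → ℕ} {n : ℕ} : pre x n = pre y n ↔ ∀ i < n, x i = y i := by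
  refine ⟨fun h i hi => ?_, pre_congr⟩
  exact congrFun (List.ofFn_injective h) ⟨i, hi⟩

lemma pre_cat_length (μ : List ℕ) (x : ℕ → ℕ) : pre (cat μ x) μ.length = μ := by
  apply List.ext_getElem (by simp)
  intro i h1 h2
  simp [pre, cat]

lemma cat_add (μ : List ℕ) (x : ℕ → ℕ) (i : ℕ) : cat μ x (μ.length + i) = x i := by
  simp [cat]

lemma pre_cat (μ : List ℕ) (x : ℕ → ℕ) (n : ℕ) : pre (cat μ x) (μ.length + n) = μ ++ pre x n := by
  rw [pre_add, pre_cat_length]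
  simp only [cat_add]

lemma xiWord_eq {β : ℝ} (hβ : 1 < β) (n : ℕ) : xiWord β n = pre (qgDigit β) n := by
  rw [xiWord, xi_eq_qgDigit hβ, pre]

lemma weight_qgDigit {β : ℝ} (hβ : 1 < β) (n : ℕ) :
    weight β 1 (pre (qgDigit β) n) = qgRem β n := by
  induction n with
  | zero => rfl
  | succ n ih => rw [pre_succ, weight_concat, ih, act_qgRem_eq hβ]

lemma weight_xiWord {β : ℝ} (hβ : 1 < β) (n : ℕ) : weight β 1 (xiWord β n) = qgRem β n := by
  rw [xiWord_eq hβ, weight_qgDigit hβ]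

/-- Horner's scheme for β_n is the recursion of the remainders, which lets the end points of the
β-adic intervals be read as weights. -/
lemma betaVal_eq_qgRem {β : ℝ} (hβ : 1 < β) (n : ℕ) : betaVal β n = qgRem β n := by
  induction n with
  | zero => simp [betaVal, qgRem]
  | succ n ih =>
    rw [qgRem_succ hβ, ← ih, betaVal, betaVal, Finset.sum_range_succ, mul_sub, Finset.mul_sum,
      xi_eq_qgDigit hβ]
    have : ∀ i ∈ Finset.range n, (qgDigit β i : ℝ) * β ^ (n + 1 - 1 - i) =
        β * (qgDigit β i * β ^ (n - 1 - i)) := by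
      intro i hi
      rw [Finset.mem_range] at hi
      rw [show n + 1 - 1 - i = (n - 1 - i) + 1 by omega, pow_succ]
      ring
    rw [Finset.sum_congr rfl this]
    simp
    ring

/-- All prefixes of `x` have positive weight when one starts with `s`. -/
def Survives (β s : ℝ) (x : ℕ → ℕ) : Prop := ∀ n, 0 < weight β s (pre x n)

lemma Survives.mono {β : ℝ} (hβ : 1 < β) {s t : ℝ} (h : s ≤ t) {x : ℕ → ℕ}
    (hs : Survives β s x) : Survives β t x := fun n => (hs n).trans_le (weight_mono hβ h _)

lemma Survives.pos {β : ℝ} {s : ℝ} {x : ℕ → ℕ} (hs : Survives β s x) : 0 < s := hs 0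

/-- The weight records how much of ξ has just been matched. A letter that exceeds ξ after a match
makes the weight nonpositive, and this is exactly a violation of the lexicographic condition by some
shift. -/
lemma mem_betaShift_iff {β : ℝ} (hβ : 1 < β) {x : ℕ → ℕ} :
    x ∈ betaShift β ↔ Survives β 1 x := by
  rw [betaShift, Set.mem_ofPred_eq, xi_eq_qgDigit hβ]
  constructor
  · rintro ⟨-, h⟩
    -- Invariant: the weight after n letters is β_k for some k such that the last k letters are the
    -- first k letters of ξ.
    have key : ∀ n, ∃ k ≤ n, weight β 1 (pre x n) = qgRem β k ∧
        ∀ i < k, x (n - k + i) = qgDigit β i := by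
      intro n
      induction n with
      | zero => exact ⟨0, le_rfl, rfl, by simp⟩
      | succ n ih =>
        obtain ⟨k, hk, hw, hx⟩ := ih
        rw [pre_succ, weight_concat, hw]
        rcases lt_trichotomy (x n) (qgDigit β k) with h1 | h1 | h1
        · exact ⟨0, by omega, act_qgRem_lt hβ h1, by simp⟩
        · refine ⟨k + 1, by omega, by rw [h1, act_qgRem_eq hβ], fun i hi => ?_⟩
          rw [show n + 1 - (k + 1) = n - k by omega]
          rcases Nat.lt_succ_iff_lt_or_eq.1 hi with h2 | rfl
          · exact hx i h2
          · rw [Nat.sub_add_cancel hk, h1]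
        · refine absurd (h (n - k)) (not_le.2 ⟨k, fun i hi => (hx i hi).symm, ?_⟩)
          change qgDigit β k < x (n - k + k)
          rwa [Nat.sub_add_cancel hk]
    intro n
    obtain ⟨k, -, hw, -⟩ := key n
    rw [hw]
    exact (qgRem_mem k).1
  · intro h
    refine ⟨fun n => ?_, fun m => ?_⟩
    · have h1 := h (n + 1)
      rw [pre_succ, weight_concat] at h1
      have h2 := (act_mono hβ (weight_le_one (β := β) le_rfl (pre x n)) (x n))
      have h3 := (h1.trans_le h2).trans_le (min_le_right _ _)
      exact Nat.lt_ceil.2 (by linarith)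
    · by_contra hlt
      obtain ⟨j, hj, hlt⟩ := not_le.1 hlt
      have hlt' : qgDigit β j < x (m + j) := hlt
      have h1 := h (m + (j + 1))
      have h2 : pre (fun i => x (m + i)) j = pre (qgDigit β) j :=
        pre_congr fun i hi => (hj i hi).symm
      rw [pre_add, weight_append, pre_succ, weight_concat, h2] at h1
      have h3 := weight_mono hβ (weight_le_one (β := β) le_rfl (pre x m)) (pre (qgDigit β) j)
      rw [weight_qgDigit hβ] at h3
      exact absurd h1 (not_lt.2 ((act_mono hβ h3 _).trans (act_qgRem_gt hβ hlt')))

lemma cat_mem_betaShift_iff {β : ℝ} (hβ : 1 < β) {μ : List ℕ} {x : ℕ → ℕ} :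
    cat μ x ∈ betaShift β ↔ Survives β (weight β 1 μ) x := by
  rw [mem_betaShift_iff hβ]
  constructor
  · intro h n
    have := h (μ.length + n)
    rwa [pre_cat, weight_append] at this
  · intro h n
    have h1 := h n
    rw [← weight_append, ← pre_cat, add_comm, pre_add, weight_append] at h1
    -- A weight that has become nonpositive never recovers, so positivity after the longer prefix
    -- gives it after the shorter one.
    exact not_le.1 fun h2 => absurd h1 (not_lt.2 (weight_nonpos hβ h2 _))

/-! ### Survival of β-expansions and the order of real numbers -/

lemma iter_lt_one {β : ℝ} {t : ℝ} (h1 : t < 1) (n : ℕ) : (betaMap β)^[n] t < 1 := by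
  cases n with
  | zero => simpa using h1
  | succ n =>
    rw [Function.iterate_succ_apply']
    have := Int.lt_floor_add_one (β * (betaMap β)^[n] t)
    simp only [betaMap]
    linarith

/-- The orbit of t stays strictly below the weight: both are multiplied by β and lowered by the same
digit, and the truncation at 1 is harmless since the orbit stays below 1. -/
lemma survives_digits {β : ℝ} (hβ : 1 < β) {t s : ℝ} (h0 : 0 ≤ t) (h1 : t < 1) (hs : t < s) :
    Survives β s (digits β t) := by
  have key : ∀ n, (betaMap β)^[n] t < weight β s (pre (digits β t) n) := by
    intro n
    induction n with
    | zero => simpa using hs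
    | succ n ih =>
      rw [pre_succ, weight_concat]
      refine lt_min (iter_lt_one h1 _) ?_
      rw [iter_succ hβ h0]
      have := mul_lt_mul_of_pos_left ih (by linarith : (0 : ℝ) < β)
      linarith
  exact fun n => (iter_nonneg h0 n).trans_lt (key n)

/-- Without the truncation at 1 this would be an equality; truncating only lowers the weight. -/
lemma weight_pre_le {β : ℝ} (hβ : 1 < β) (s : ℝ) (x : ℕ → ℕ) (n : ℕ) :
    weight β s (pre x n) / β ^ n + ∑ i ∈ Finset.range n, (x i : ℝ) / β ^ (i + 1) ≤ s := by
  have hb : (0 : ℝ) < β := by linarith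
  induction n with
  | zero => simp
  | succ n ih =>
    refine le_trans ?_ ih
    rw [pre_succ, weight_concat, Finset.sum_range_succ]
    have h : act β (weight β s (pre x n)) (x n) / β ^ (n + 1) ≤
        (β * weight β s (pre x n) - x n) / β ^ (n + 1) := by
      gcongr
      exact min_le_right _ _
    have h2 : (β * weight β s (pre x n) - x n) / β ^ (n + 1) + x n / β ^ (n + 1) =
        weight β s (pre x n) / β ^ n := by
      field_simp
      ring
    linarith

lemma digits_sum {β : ℝ} (hβ : 1 < β) {t : ℝ} (h0 : 0 ≤ t) (n : ℕ) :
    t = ∑ i ∈ Finset.range n, (digits β t i : ℝ) / β ^ (i + 1) + (betaMap β)^[n] t / β ^ n := by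
  have hb : (0 : ℝ) < β := by linarith
  induction n with
  | zero => simp
  | succ n ih =>
    rw [Finset.sum_range_succ, iter_succ hβ h0]
    have : (β * (betaMap β)^[n] t - digits β t n) / β ^ (n + 1) =
      (betaMap β)^[n] t / β ^ n - digits β t n / β ^ (n + 1) := by
      field_simp
      ring
    linarith

lemma le_of_survives_digits {β : ℝ} (hβ : 1 < β) {t s : ℝ} (h0 : 0 ≤ t) (h1 : t < 1)
    (hs : Survives β s (digits β t)) : t ≤ s := by
  have hb : (0 : ℝ) < β := by linarith
  have h : ∀ n : ℕ, t - (1 / β) ^ n ≤ s := by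
    intro n
    have h2 := weight_pre_le hβ s (digits β t) n
    have h3 := digits_sum hβ h0 n
    have h4 : 0 < weight β s (pre (digits β t) n) / β ^ n := div_pos (hs n) (by positivity)
    have h5 : (betaMap β)^[n] t / β ^ n ≤ (1 / β) ^ n := by
      rw [div_pow, one_pow]
      gcongr
      exact (iter_lt_one h1 n).le
    linarith
  have hl := (tendsto_pow_atTop_nhds_zero_of_lt_one (by positivity)
    ((div_lt_one hb).2 hβ)).const_sub t
  rw [sub_zero] at hl
  exact le_of_tendsto' hl h

/-- The remainders take only finitely many values if the shift is sofic. -/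
lemma remSet_finite {β : ℝ} (hβ : 1 < β) (hs : IsSofic (betaShift β)) : (remSet β).Finite := by
  obtain ⟨k, E, hE⟩ := hs
  -- The states of the graph that can be reached by reading the first n letters of ξ.
  let S : ℕ → Set (Fin k) := fun n =>
    {q | ∃ v : ℕ → Fin k, (∀ i < n, (v i, qgDigit β i, v (i + 1)) ∈ E) ∧ v n = q}
  have hmem : ∀ n x, cat (pre (qgDigit β) n) x ∈ betaShift β ↔ Survives β (qgRem β n) x := by
    intro n x
    rw [cat_mem_betaShift_iff hβ, weight_qgDigit hβ]
  have hlow : ∀ (n x) (i), i < n → cat (pre (qgDigit β) n) x i = qgDigit β i := by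
    intro n x i hi
    simp [cat, pre, hi]
  have hhigh : ∀ (n x) (i), cat (pre (qgDigit β) n) x (n + i) = x i := by
    intro n x i
    simpa using cat_add (pre (qgDigit β) n) x i
  -- A path that has read m letters of ξ can be spliced at its state onto one that has read n
  -- letters and ends there, so equal state sets allow the same continuations.
  have hglue : ∀ m n, S m = S n → ∀ x, cat (pre (qgDigit β) m) x ∈ betaShift β →
      cat (pre (qgDigit β) n) x ∈ betaShift β := by
    intro m n hmn x hx
    rw [hE] at hx ⊢
    obtain ⟨v, hv⟩ := hx
    have : v m ∈ S m := ⟨v, fun i hi => by simpa only [hlow m x i hi] using hv i, rfl⟩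
    rw [hmn] at this
    obtain ⟨v', hv', he⟩ := this
    refine ⟨fun i => if i ≤ n then v' i else v (m + (i - n)), fun i => ?_⟩
    beta_reduce
    rcases lt_trichotomy i n with h | rfl | h
    · rw [if_pos h.le, if_pos (by omega), hlow n x i h]
      exact hv' i h
    · rw [if_pos le_rfl, if_neg (by omega), he]
      have := hv m
      have h1 := hhigh m x 0
      have h2 := hhigh i x 0
      rw [add_zero] at h1 h2
      rw [h1] at this
      rw [h2]
      simpa using this
    · rw [if_neg (by omega), if_neg (by omega)]
      have := hv (m + (i - n))
      rw [hhigh] at this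
      obtain ⟨j, rfl⟩ := Nat.exists_eq_add_of_lt h
      rw [show n + j + 1 = n + (j + 1) by omega, hhigh]
      convert this using 3 <;> congr 1 <;> omega
  have hle : ∀ m n, S m = S n → qgRem β n ≤ qgRem β m := by
    intro m n hmn
    by_contra! hlt
    -- The expansion of a number strictly between the two remainders may follow one prefix of ξ but
    -- not the other.
    obtain ⟨t, ht1, ht2⟩ := exists_between hlt
    have ht0 : 0 ≤ t := (qgRem_mem m).1.le.trans ht1.le
    have ht3 : t < 1 := ht2.trans_le (qgRem_mem n).2
    have h1 := hglue n m hmn.symm _ ((hmem n _).2 (survives_digits hβ ht0 ht3 ht2))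
    exact absurd (le_of_survives_digits hβ ht0 ht3 ((hmem m _).1 h1)) (not_le.2 ht1)
  -- The remainder depends only on the state set, and a finite graph has finitely many sets of
  -- states.
  have : remSet β ⊆ (fun T : Set (Fin k) => qgRem β (Function.invFun S T)) '' Set.univ := by
    rintro _ ⟨n, rfl⟩
    have h : S (Function.invFun S (S n)) = S n := Function.invFun_eq ⟨n, rfl⟩
    exact ⟨S n, trivial, le_antisymm (hle _ _ h.symm) (hle _ _ h)⟩
  exact (Set.toFinite _).subset this

/-! ### Vertices -/

/-- The largest element of `remSet β` below `ρ`, and `0` if there is none. -/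
def low (β ρ : ℝ) : ℝ := sSup (insert 0 {r | r ∈ remSet β ∧ r < ρ})

lemma low_spec {β : ℝ} (hf : (remSet β).Finite) (ρ : ℝ) :
    low β ρ ∈ insert 0 {r | r ∈ remSet β ∧ r < ρ} ∧ 0 ≤ low β ρ ∧
      ∀ r ∈ remSet β, r < ρ → r ≤ low β ρ := by
  have hfin : (insert 0 {r | r ∈ remSet β ∧ r < ρ}).Finite :=
    (hf.subset fun r hr => hr.1).insert 0
  refine ⟨(Set.insert_nonempty _ _).csSup_mem hfin, ?_, fun r hr h => ?_⟩
  · exact le_csSup hfin.bddAbove (Set.mem_insert _ _)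
  · exact le_csSup hfin.bddAbove (Set.mem_insert_of_mem _ ⟨hr, h⟩)

lemma low_nonneg {β : ℝ} (hf : (remSet β).Finite) (ρ : ℝ) : 0 ≤ low β ρ := (low_spec hf ρ).2.1

lemma le_low {β : ℝ} (hf : (remSet β).Finite) {ρ r : ℝ} (hr : r ∈ remSet β) (h : r < ρ) :
    r ≤ low β ρ := (low_spec hf ρ).2.2 r hr h

lemma low_lt {β : ℝ} (hf : (remSet β).Finite) {ρ : ℝ} (hρ : 0 < ρ) : low β ρ < ρ := by
  rcases (low_spec hf ρ).1 with h | h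
  · rwa [h]
  · exact h.2

/-- `u` is the vertex of the points of `X_β` that may follow exactly the words of weight at least
`ρ`. -/
def HasThreshold (β : ℝ) (u : List ℕ → Bool) (ρ : ℝ) : Prop :=
  ρ ∈ remSet β ∧ ∀ μ, u μ = true ↔ ρ ≤ weight β 1 μ

/-- The remainders from which x survives are closed upwards within the finite set `remSet β`; the
threshold is the least of them. -/
lemma exists_survival_threshold {β : ℝ} (hβ : 1 < β) (hf : (remSet β).Finite) {x : ℕ → ℕ}
    (hx : x ∈ betaShift β) : ∃ ρ ∈ remSet β, ∀ μ, cat μ x ∈ betaShift β ↔ ρ ≤ weight β 1 μ := by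
  have hne : {r | r ∈ remSet β ∧ Survives β r x}.Nonempty :=
    ⟨1, one_mem_remSet β, (mem_betaShift_iff hβ).1 hx⟩
  have hfin : {r | r ∈ remSet β ∧ Survives β r x}.Finite := hf.subset fun r hr => hr.1
  have h := hne.csInf_mem hfin
  refine ⟨_, h.1, fun μ => ?_⟩
  rw [cat_mem_betaShift_iff hβ]
  constructor
  · intro hs
    exact csInf_le hfin.bddBelow ⟨weight_mem_remSet hβ (one_mem_remSet β) hs.pos, hs⟩
  · intro hle
    exact h.2.mono hβ hle

lemma HasThreshold.unique {β : ℝ} (hβ : 1 < β) {u : List ℕ → Bool} {ρ ρ' : ℝ}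
    (h : HasThreshold β u ρ) (h' : HasThreshold β u ρ') : ρ = ρ' := by
  obtain ⟨⟨n, rfl⟩, h2⟩ := h
  obtain ⟨⟨m, rfl⟩, h4⟩ := h'
  have h5 := h2 (xiWord β n)
  have h6 := h4 (xiWord β m)
  rw [h4, weight_xiWord hβ] at h5
  rw [h2, weight_xiWord hβ] at h6
  exact le_antisymm (h6.2 le_rfl) (h5.2 le_rfl)

lemma HasThreshold.isVertex {β : ℝ} (hβ : 1 < β) (hf : (remSet β).Finite) {u : List ℕ → Bool}
    {ρ : ℝ} (h : HasThreshold β u ρ) : IsVertex β u := by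
  -- No remainder lies strictly between `low β ρ` and ρ, so the expansion of any t in this gap has
  -- exactly the prescribed past, at all levels at once.
  obtain ⟨t, ht1, ht2⟩ := exists_between (low_lt hf (remSet_pos h.1))
  have ht0 := (low_nonneg hf ρ).trans ht1.le
  have ht3 := ht2.trans_le (remSet_le_one h.1)
  intro l
  refine ⟨digits β t, (mem_betaShift_iff hβ).2 (survives_digits hβ ht0 ht3 ht3), fun μ _ => ?_⟩
  rw [h.2, cat_mem_betaShift_iff hβ]
  constructor
  · intro h'
    exact survives_digits hβ ht0 ht3 (ht2.trans_le h')
  · intro hs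
    have h1 := le_of_survives_digits hβ ht0 ht3 hs
    by_contra! hlt
    exact absurd (le_low hf (weight_mem_remSet hβ (one_mem_remSet β) hs.pos) hlt)
      (not_le.2 (ht1.trans_le h1))

lemma IsVertex.exists_threshold {β : ℝ} (hβ : 1 < β) (hf : (remSet β).Finite)
    {u : List ℕ → Bool} (hu : IsVertex β u) : ∃ ρ, HasThreshold β u ρ := by
  -- Finitely many prefixes of ξ, of length at most L, realize all remainders as weights. Level L
  -- thus determines the threshold, and higher levels cannot change it.
  have hidx : ∃ L : ℕ, ∀ r ∈ remSet β, ∃ n ≤ L, qgRem β n = r := by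
    choose! g hg using fun (r : ℝ) (hr : r ∈ remSet β) => hr
    obtain ⟨L, hL⟩ := (hf.image g).bddAbove
    exact ⟨L, fun r hr => ⟨g r, hL ⟨r, hr, rfl⟩, hg r hr⟩⟩
  obtain ⟨L, hL⟩ := hidx
  obtain ⟨x, hx, hux⟩ := hu L
  obtain ⟨ρ, hρ, h⟩ := exists_survival_threshold hβ hf hx
  refine ⟨ρ, hρ, fun μ => ?_⟩
  obtain ⟨x', hx', hux'⟩ := hu (max L μ.length)
  obtain ⟨ρ', hρ', h'⟩ := exists_survival_threshold hβ hf hx'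
  have hlen : ∀ n, (xiWord β n).length = n := fun n => by simp [xiWord]
  have key : ∀ r ∈ remSet β, ρ ≤ r ↔ ρ' ≤ r := by
    intro r hr
    obtain ⟨n, hn, rfl⟩ := hL r hr
    have h1 := hux (xiWord β n) (by rw [hlen]; exact hn)
    have h2 := hux' (xiWord β n) (by rw [hlen]; exact hn.trans (le_max_left _ _))
    rw [h, weight_xiWord hβ] at h1
    rw [h', weight_xiWord hβ] at h2
    rw [← h1, ← h2]
  have : ρ = ρ' := le_antisymm ((key _ hρ').2 le_rfl) ((key _ hρ).1 le_rfl)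
  rw [hux' μ (le_max_right _ _), h', this]

/-- The threshold of a vertex. -/
def thr (β : ℝ) (u : List ℕ → Bool) : ℝ := Classical.epsilon (HasThreshold β u)

lemma HasThreshold.thr_eq {β : ℝ} (hβ : 1 < β) {u : List ℕ → Bool} {ρ : ℝ}
    (h : HasThreshold β u ρ) : thr β u = ρ :=
  HasThreshold.unique hβ (Classical.epsilon_spec ⟨ρ, h⟩) h

lemma IsVertex.hasThreshold {β : ℝ} (hβ : 1 < β) (hf : (remSet β).Finite) {u : List ℕ → Bool}
    (hu : IsVertex β u) : HasThreshold β u (thr β u) :=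
  Classical.epsilon_spec (hu.exists_threshold hβ hf)

lemma vertex_ext {β : ℝ} {u v : List ℕ → Bool} {ρ : ℝ} (hu : HasThreshold β u ρ)
    (hv : HasThreshold β v ρ) : u = v := by
  funext μ
  rw [Bool.eq_iff_iff, hu.2, hv.2]

lemma setOf_isVertex_finite {β : ℝ} (hβ : 1 < β) (hf : (remSet β).Finite) :
    {u | IsVertex β u}.Finite := by
  refine Set.Finite.of_finite_image (f := thr β) (hf.subset ?_) ?_
  · rintro _ ⟨u, hu, rfl⟩
    exact (IsVertex.hasThreshold hβ hf hu).1
  · intro u hu v hv h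
    have h1 := IsVertex.hasThreshold hβ hf hu
    rw [h] at h1
    exact vertex_ext h1 (IsVertex.hasThreshold hβ hf hv)

/-! ### Thresholds along a path -/

namespace UnitSpace

variable {β : ℝ}

/-- The labels of a path. -/
def lab (z : UnitSpace β) (n : ℕ) : ℕ := z.1.1 n

/-- The vertices of a path. -/
def ver (z : UnitSpace β) (n : ℕ) : List ℕ → Bool := z.1.2 n

/-- The thresholds of the vertices of a path. -/
def th (z : UnitSpace β) (n : ℕ) : ℝ := thr β (z.ver n)

lemma isVertex (z : UnitSpace β) (n : ℕ) : IsVertex β (z.ver n) := z.2.1 n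

lemma ver_eq (z : UnitSpace β) (n : ℕ) (μ : List ℕ) :
    z.ver n μ = z.ver (n + 1) (μ ++ [z.lab n]) := (z.2.2 n).2 μ

lemma ext' {z z' : UnitSpace β} (h1 : ∀ n, z.lab n = z'.lab n) (h2 : ∀ n, z.ver n = z'.ver n) :
    z = z' :=
  Subtype.ext (Prod.ext (funext h1) (funext h2))

lemma lab_iterate (z : UnitSpace β) (k n : ℕ) : ((shiftMap β)^[k] z).lab n = z.lab (k + n) := by
  induction k generalizing z with
  | zero => simp
  | succ k ih =>
    rw [Function.iterate_succ_apply, ih]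
    exact congrArg z.lab (by omega)

lemma ver_iterate (z : UnitSpace β) (k n : ℕ) : ((shiftMap β)^[k] z).ver n = z.ver (k + n) := by
  induction k generalizing z with
  | zero => simp
  | succ k ih =>
    rw [Function.iterate_succ_apply, ih]
    exact congrArg z.ver (by omega)

lemma th_iterate (z : UnitSpace β) (k n : ℕ) : ((shiftMap β)^[k] z).th n = z.th (k + n) := by
  rw [th, ver_iterate, th]

lemma hasThreshold (hβ : 1 < β) (hf : (remSet β).Finite) (z : UnitSpace β) (n : ℕ) :
    HasThreshold β (z.ver n) (z.th n) := (z.isVertex n).hasThreshold hβ hf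

lemma ver_eq_true_iff (hβ : 1 < β) (hf : (remSet β).Finite) (z : UnitSpace β) (n : ℕ)
    (μ : List ℕ) : z.ver n μ = true ↔ z.th n ≤ weight β 1 μ := (z.hasThreshold hβ hf n).2 μ

lemma th_mem (hβ : 1 < β) (hf : (remSet β).Finite) (z : UnitSpace β) (n : ℕ) :
    z.th n ∈ remSet β := (z.hasThreshold hβ hf n).1

lemma ver_congr (hβ : 1 < β) (hf : (remSet β).Finite) {z z' : UnitSpace β} {m n : ℕ}
    (h : z.th m = z'.th n) : z.ver m = z'.ver n := by
  have h1 := z.hasThreshold hβ hf m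
  rw [h] at h1
  exact vertex_ext h1 (z'.hasThreshold hβ hf n)

lemma ver_pre (z : UnitSpace β) (m n : ℕ) (μ : List ℕ) :
    z.ver m μ = z.ver (m + n) (μ ++ pre (fun i => z.lab (m + i)) n) := by
  induction n with
  | zero => simp
  | succ n ih =>
    rw [ih, ver_eq, pre_succ, List.append_assoc]
    rfl

lemma ver_pre_true (z : UnitSpace β) (n : ℕ) : z.ver n (pre z.lab n) = true := by
  cases n with
  | zero =>
    obtain ⟨x, hx, h⟩ := z.isVertex 0 0
    exact (h [] (by simp)).2 hx
  | succ n =>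
    have h := ver_pre_true z n
    rw [ver_eq, ← pre_succ] at h
    exact h

/-- The edge relation, tested on a prefix of ξ of weight r: the threshold is at most r iff the next
one is at most `act β r` of the label. -/
lemma th_le_iff (hβ : 1 < β) (hf : (remSet β).Finite) (z : UnitSpace β) (n : ℕ) {r : ℝ}
    (hr : r ∈ remSet β) : z.th n ≤ r ↔ z.th (n + 1) + z.lab n ≤ β * r := by
  obtain ⟨k, rfl⟩ := hr
  rw [← weight_xiWord hβ, ← ver_eq_true_iff hβ hf, ver_eq, ver_eq_true_iff hβ hf, weight_concat,
    act, le_min_iff, and_iff_right (remSet_le_one (z.th_mem hβ hf _))]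
  constructor <;> intro h <;> linarith

lemma th_step (hβ : 1 < β) (hf : (remSet β).Finite) (z : UnitSpace β) (n : ℕ) :
    z.th (n + 1) + z.lab n ≤ β * z.th n :=
  (z.th_le_iff hβ hf n (z.th_mem hβ hf n)).1 le_rfl

/-- Together with `th_step` this says that t ↦ (label + t)/β maps the interval of the next vertex
into that of the present one. If β·low − label is positive, it is an untruncated weight below the
next threshold, hence itself a smaller remainder. -/
lemma low_step (hβ : 1 < β) (hf : (remSet β).Finite) (z : UnitSpace β) (n : ℕ) :
    β * low β (z.th n) ≤ low β (z.th (n + 1)) + z.lab n := by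
  rcases (low_spec hf (z.th n)).1 with h | ⟨h1, h2⟩
  · rw [h, mul_zero]
    exact add_nonneg (low_nonneg hf _) (Nat.cast_nonneg _)
  · have h3 : β * low β (z.th n) < z.th (n + 1) + z.lab n := by
      rw [← not_le, ← th_le_iff hβ hf z n h1, not_le]
      exact h2
    rcases le_or_gt (β * low β (z.th n) - z.lab n) 0 with h4 | h4
    · have := low_nonneg hf (z.th (n + 1))
      linarith
    · have h5 := remSet_le_one (z.th_mem hβ hf (n + 1))
      have h6 : act β (low β (z.th n)) (z.lab n) = β * low β (z.th n) - z.lab n :=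
        min_eq_right (by linarith)
      have h7 := act_mem_remSet hβ h1 (h6 ▸ h4)
      rw [h6] at h7
      have := le_low hf h7 (by linarith : _ < z.th (n + 1))
      linarith

lemma lab_le (hβ : 1 < β) (hf : (remSet β).Finite) (z : UnitSpace β) (n : ℕ) :
    (z.lab n : ℝ) ≤ β := by
  have h1 := z.th_step hβ hf n
  have h2 := remSet_pos (z.th_mem hβ hf (n + 1))
  have h3 := mul_le_mul_of_nonneg_left (remSet_le_one (z.th_mem hβ hf n)) (by linarith : 0 ≤ β)
  linarith

/-- The left end of the cylinder of the first `n` labels. -/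
def lsum (z : UnitSpace β) (n : ℕ) : ℝ := ∑ i ∈ Finset.range n, (z.lab i : ℝ) / β ^ (i + 1)

lemma lsum_succ (z : UnitSpace β) (n : ℕ) : z.lsum (n + 1) = z.lsum n + z.lab n / β ^ (n + 1) :=
  Finset.sum_range_succ _ _

lemma leftEnd_pre (z : UnitSpace β) (n : ℕ) : leftEnd β (pre z.lab n) = z.lsum n := by
  rw [leftEnd, lsum, ← Fin.sum_univ_eq_sum_range (fun i => (z.lab i : ℝ) / β ^ (i + 1))]
  refine Fintype.sum_equiv (finCongr (pre_length _ _)) _ _ fun i => ?_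
  have h : (pre z.lab n)[(i : ℕ)] = z.lab i := by simp [pre]
  simp [h]

/-! ### The value of a path, bounded by the end points of its cylinders -/

lemma summable (hβ : 1 < β) (hf : (remSet β).Finite) (z : UnitSpace β) :
    Summable fun n => (z.lab n : ℝ) / β ^ (n + 1) := by
  have hb : (0 : ℝ) < β := by linarith
  refine Summable.of_nonneg_of_le (fun n => by positivity) (fun n => ?_)
    (summable_geometric_of_lt_one (by positivity) ((div_lt_one hb).2 hβ))
  rw [div_pow, one_pow, pow_succ, div_le_div_iff₀ (by positivity) (by positivity)]
  have := mul_le_mul_of_nonneg_right (z.lab_le hβ hf n) (by positivity : 0 ≤ β ^ n)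
  linarith

lemma tendsto_lsum (hβ : 1 < β) (hf : (remSet β).Finite) (z : UnitSpace β) :
    Filter.Tendsto z.lsum Filter.atTop (nhds (coding z)) :=
  (z.summable hβ hf).hasSum.tendsto_sum_nat

lemma coding_eq (hβ : 1 < β) (hf : (remSet β).Finite) (z : UnitSpace β) (n : ℕ) :
    coding z = z.lsum n + coding ((shiftMap β)^[n] z) / β ^ n := by
  rw [coding, lsum]
  refine ((z.summable hβ hf).sum_add_tsum_nat_add n).symm.trans ?_
  congr 1
  rw [coding, ← tsum_div_const]
  refine tsum_congr fun i => ?_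
  change _ = (((shiftMap β)^[n] z).lab i : ℝ) / β ^ (i + 1) / β ^ n
  rw [lab_iterate, div_div, ← pow_add, add_comm n i]
  congr 2
  omega

lemma coding_step (hβ : 1 < β) (hf : (remSet β).Finite) (z : UnitSpace β) (n : ℕ) :
    β * coding ((shiftMap β)^[n] z) = coding ((shiftMap β)^[n + 1] z) + z.lab n := by
  have hb : (0 : ℝ) < β := by linarith
  have h := coding_eq hβ hf ((shiftMap β)^[n] z) 1
  rw [← Function.iterate_add_apply, add_comm 1 n, lsum, Finset.sum_range_one, lab_iterate] at h
  rw [h]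
  simp
  field_simp
  ring

lemma lsum_add_th_le (hβ : 1 < β) (hf : (remSet β).Finite) (z : UnitSpace β) (n : ℕ) :
    z.lsum n + z.th n / β ^ n ≤ z.th 0 := by
  have hb : (0 : ℝ) < β := by linarith
  induction n with
  | zero => simp [lsum]
  | succ n ih =>
    have h1 := z.th_step hβ hf n
    have h2 : (z.th (n + 1) + z.lab n) / β ^ (n + 1) ≤ β * z.th n / β ^ (n + 1) := by gcongr
    have h3 : β * z.th n / β ^ (n + 1) = z.th n / β ^ n := by field_simp; ring
    rw [lsum_succ]
    rw [add_div] at h2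
    linarith

lemma coding_le_th (hβ : 1 < β) (hf : (remSet β).Finite) (z : UnitSpace β) :
    coding z ≤ z.th 0 := by
  have hb : (0 : ℝ) < β := by linarith
  refine le_of_tendsto' (z.tendsto_lsum hβ hf) fun n => ?_
  have : 0 < z.th n / β ^ n := div_pos (remSet_pos (z.th_mem hβ hf n)) (by positivity)
  linarith [z.lsum_add_th_le hβ hf n]

lemma low_le_coding (hβ : 1 < β) (hf : (remSet β).Finite) (z : UnitSpace β) :
    low β (z.th 0) ≤ coding z := by
  have hb : (0 : ℝ) < β := by linarith
  -- The left ends of the nested intervals increase and converge to the value, because the lengths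
  -- are at most β^(-n).
  have key : ∀ n : ℕ, low β (z.th 0) ≤ z.lsum n + low β (z.th n) / β ^ n := by
    intro n
    induction n with
    | zero => simp [lsum]
    | succ n ih =>
      have h1 := z.low_step hβ hf n
      have h2 : β * low β (z.th n) / β ^ (n + 1) ≤
        (low β (z.th (n + 1)) + z.lab n) / β ^ (n + 1) := by gcongr
      have h3 : β * low β (z.th n) / β ^ (n + 1) = low β (z.th n) / β ^ n := by field_simp; ring
      rw [lsum_succ]
      rw [add_div] at h2
      linarith
  have h2 : ∀ n : ℕ, low β (z.th 0) ≤ z.lsum n + (1 / β) ^ n := by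
    intro n
    refine (key n).trans (add_le_add le_rfl ?_)
    rw [div_pow, one_pow]
    have := (low_lt hf (remSet_pos (z.th_mem hβ hf n))).le.trans
      (remSet_le_one (z.th_mem hβ hf n))
    gcongr
  have hl := (z.tendsto_lsum hβ hf).add (tendsto_pow_atTop_nhds_zero_of_lt_one
    (by positivity : 0 ≤ 1 / β) ((div_lt_one hb).2 hβ))
  rw [add_zero] at hl
  exact ge_of_tendsto' hl h2

end UnitSpace

/-! ### The topology of the unit space -/

namespace UnitSpace

open Topology Filter

variable {β : ℝ}

instance : T2Space (UnitSpace β) := inferInstanceAs (T2Space (Subtype _))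

lemma continuous_lab (n : ℕ) : Continuous fun z : UnitSpace β => z.lab n :=
  (continuous_apply n).comp (continuous_fst.comp continuous_subtype_val)

lemma continuous_ver (n : ℕ) : Continuous fun z : UnitSpace β => z.ver n :=
  (continuous_apply n).comp (continuous_snd.comp continuous_subtype_val)

lemma continuous_eval_discrete {Z ι : Type*} [TopologicalSpace Z] {f : Z → ℕ} (hf : Continuous f)
    {g : Z → ι → Bool} (hg : Continuous g) (φ : ℕ → ι) : Continuous fun z => g z (φ (f z)) := by
  rw [continuous_iff_continuousAt]
  intro z
  have h : ∀ᶠ z' in 𝓝 z, f z' = f z :=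
    hf.continuousAt.eventually ((isOpen_discrete {f z}).mem_nhds rfl)
  refine ContinuousAt.congr (f := fun z' => g z' (φ (f z)))
    ((continuous_apply _).comp hg).continuousAt ?_
  filter_upwards [h] with z' hz'
  rw [hz']

/-- Labels are bounded by β and there are finitely many vertices, so the paths form a closed subset
of a product of finite sets. -/
lemma compactSpace (hβ : 1 < β) (hf : (remSet β).Finite) : CompactSpace (UnitSpace β) := by
  have hK : IsCompact ((Set.univ.pi fun _ : ℕ => {a : ℕ | (a : ℝ) ≤ β}) ×ˢ
      (Set.univ.pi fun _ : ℕ => {u | IsVertex β u})) := by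
    refine IsCompact.prod (isCompact_univ_pi fun _ => Set.Finite.isCompact ?_)
      (isCompact_univ_pi fun _ => (setOf_isVertex_finite hβ hf).isCompact)
    refine (Set.finite_le_nat ⌊β⌋₊).subset fun a ha => ?_
    exact Nat.le_floor ha
  have hC : IsClosed {z : (ℕ → ℕ) × (ℕ → List ℕ → Bool) |
      ∀ n, IsEdge (z.2 n) (z.1 n) (z.2 (n + 1))} := by
    have hx : ∀ n, Continuous fun z : (ℕ → ℕ) × (ℕ → List ℕ → Bool) => z.1 n := fun n =>
      (continuous_apply n).comp continuous_fst
    have hu : ∀ n, Continuous fun z : (ℕ → ℕ) × (ℕ → List ℕ → Bool) => z.2 n := fun n =>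
      (continuous_apply n).comp continuous_snd
    simp only [IsEdge, Set.ofPred_forall, Set.ofPred_and]
    refine isClosed_iInter fun n => IsClosed.inter ?_ (isClosed_iInter fun μ => ?_)
    · exact isClosed_eq (continuous_eval_discrete (hx n) (hu (n + 1)) fun a => [a])
        continuous_const
    · exact isClosed_eq ((continuous_apply μ).comp (hu n))
        (continuous_eval_discrete (hx n) (hu (n + 1)) fun a => μ ++ [a])
  have hS : IsCompact {z : (ℕ → ℕ) × (ℕ → List ℕ → Bool) |
      (∀ n, IsVertex β (z.2 n)) ∧ ∀ n, IsEdge (z.2 n) (z.1 n) (z.2 (n + 1))} := by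
    refine (hK.inter_right hC).of_isClosed_subset ?_ ?_
    · have hV : IsClosed {z : (ℕ → ℕ) × (ℕ → List ℕ → Bool) | ∀ n, IsVertex β (z.2 n)} := by
        simp only [Set.ofPred_forall]
        exact isClosed_iInter fun n => IsClosed.preimage
          (f := fun z : (ℕ → ℕ) × (ℕ → List ℕ → Bool) => z.2 n)
          ((continuous_apply n).comp continuous_snd) (setOf_isVertex_finite hβ hf).isClosed
      exact hV.inter hC
    · intro z hz
      refine ⟨⟨fun n _ => ?_, fun n _ => hz.1 n⟩, hz.2⟩
      exact lab_le hβ hf (⟨z, hz⟩ : UnitSpace β) n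
  exact isCompact_iff_compactSpace.1 hS

/-- The paths `z` and `z'` have the same first `n` edges. -/
def Agree (n : ℕ) (z z' : UnitSpace β) : Prop :=
  (∀ i < n, z.lab i = z'.lab i) ∧ z.ver n = z'.ver n

lemma Agree.refl (n : ℕ) (z : UnitSpace β) : Agree n z z := ⟨fun _ _ => rfl, rfl⟩

lemma Agree.symm {n : ℕ} {z z' : UnitSpace β} (h : Agree n z z') : Agree n z' z :=
  ⟨fun i hi => (h.1 i hi).symm, h.2.symm⟩

lemma Agree.trans {n : ℕ} {z z' z'' : UnitSpace β} (h : Agree n z z') (h' : Agree n z' z'') :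
    Agree n z z'' :=
  ⟨fun i hi => (h.1 i hi).trans (h'.1 i hi), h.2.trans h'.2⟩

/-- An edge determines its initial vertex from its label and its terminal vertex, so comparing the
last vertex is enough. -/
lemma Agree.ver {n : ℕ} {z z' : UnitSpace β} (h : Agree n z z') {i : ℕ} (hi : i ≤ n) :
    z.ver i = z'.ver i := by
  funext μ
  obtain ⟨k, rfl⟩ := Nat.exists_eq_add_of_le hi
  rw [z.ver_pre i k, z'.ver_pre i k, h.2,
    pre_congr fun j (hj : j < k) => h.1 (i + j) (by omega)]

lemma Agree.mono {n m : ℕ} (hmn : m ≤ n) {z z' : UnitSpace β} (h : Agree n z z') :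
    Agree m z z' :=
  ⟨fun i hi => h.1 i (by omega), h.ver hmn⟩

lemma Agree.iterate {n m : ℕ} {z z' : UnitSpace β} (h : Agree (m + n) z z') :
    Agree n ((shiftMap β)^[m] z) ((shiftMap β)^[m] z') := by
  refine ⟨fun i hi => ?_, ?_⟩
  · rw [lab_iterate, lab_iterate]
    exact h.1 _ (by omega)
  · rw [ver_iterate, ver_iterate]
    exact h.2

lemma Agree.of_iterate {n m : ℕ} {z z' : UnitSpace β} (h1 : ∀ i < m, z.lab i = z'.lab i)
    (h2 : Agree n ((shiftMap β)^[m] z) ((shiftMap β)^[m] z')) : Agree (m + n) z z' := by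
  refine ⟨fun i hi => ?_, ?_⟩
  · rcases lt_or_ge i m with h | h
    · exact h1 i h
    · obtain ⟨j, rfl⟩ := Nat.exists_eq_add_of_le h
      have := h2.1 j (by omega)
      rwa [lab_iterate, lab_iterate] at this
  · have := h2.2
    rwa [ver_iterate, ver_iterate] at this

lemma eq_of_iterate {m : ℕ} {z z' : UnitSpace β} (h1 : ∀ i < m, z.lab i = z'.lab i)
    (h2 : (shiftMap β)^[m] z = (shiftMap β)^[m] z') : z = z' := by
  have h : ∀ n, Agree (m + n) z z' := fun n => Agree.of_iterate h1 (h2 ▸ Agree.refl n _)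
  exact ext' (fun n => (h (n + 1)).1 n (by omega)) fun n => (h n).ver (by omega)

lemma agree_eventually (hβ : 1 < β) (hf : (remSet β).Finite) (z : UnitSpace β) (n : ℕ) :
    ∀ᶠ z' in 𝓝 z, Agree n z' z := by
  refine Filter.Eventually.and ?_ ?_
  · refine (eventually_all_finite (Set.finite_lt_nat n)).2 fun i _ => ?_
    exact (continuous_lab i).continuousAt.eventually ((isOpen_discrete {z.lab i}).mem_nhds rfl)
  · have hfin := (setOf_isVertex_finite hβ hf).subset
      (Set.sdiff_subset (s := {u | IsVertex β u}) (t := {z.ver n}))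
    have := (continuous_ver (β := β) n).continuousAt.eventually
      (hfin.isClosed.isOpen_compl.mem_nhds (x := z.ver n) (by simp))
    filter_upwards [this] with z' hz'
    by_contra hne
    exact hz' ⟨z'.isVertex n, hne⟩

lemma exists_agree_subset {z : UnitSpace β} {V : Set (UnitSpace β)} (hV : V ∈ 𝓝 z) :
    ∃ n, ∀ z', Agree n z' z → z' ∈ V := by
  by_contra! h
  choose w hw hwV using h
  have ht : Tendsto w atTop (𝓝 z) := by
    refine tendsto_subtype_rng.2 (Tendsto.prodMk_nhds ?_ ?_)
    · refine tendsto_pi_nhds.2 fun i => tendsto_const_nhds.congr' ?_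
      filter_upwards [eventually_gt_atTop i] with n hn
      exact ((hw n).1 i hn).symm
    · refine tendsto_pi_nhds.2 fun i => tendsto_const_nhds.congr' ?_
      filter_upwards [eventually_ge_atTop i] with n hn
      exact ((hw n).ver hn).symm
  obtain ⟨n, hn⟩ := (ht.eventually hV).exists
  exact hwV n hn

lemma eventually_iff_agree (hβ : 1 < β) (hf : (remSet β).Finite) {z : UnitSpace β}
    {p : UnitSpace β → Prop} : (∀ᶠ z' in 𝓝 z, p z') ↔ ∃ n, ∀ z', Agree n z' z → p z' :=
  ⟨fun h => exists_agree_subset h, fun ⟨n, h⟩ => (agree_eventually hβ hf z n).mono h⟩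

lemma isOpen_agree (hβ : 1 < β) (hf : (remSet β).Finite) (n : ℕ) (z : UnitSpace β) :
    IsOpen {z' | Agree n z' z} := by
  rw [isOpen_iff_mem_nhds]
  intro z' hz'
  exact (agree_eventually hβ hf z' n).mono fun w hw => hw.trans hz'

lemma isClosed_agree (hβ : 1 < β) (hf : (remSet β).Finite) (n : ℕ) (z : UnitSpace β) :
    IsClosed {z' | Agree n z' z} := by
  rw [← isOpen_compl_iff, isOpen_iff_mem_nhds]
  intro z' hz'
  exact (agree_eventually hβ hf z' n).mono fun w hw h => hz' (hw.symm.trans h)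

/-- A property of cylinders that holds locally holds uniformly. -/
lemma exists_uniform (hβ : 1 < β) (hf : (remSet β).Finite) {p : ℕ → UnitSpace β → Prop}
    (hp : ∀ z, ∃ n, ∀ m ≥ n, ∀ z', Agree n z' z → p m z') : ∃ n, ∀ z, p n z := by
  have := compactSpace hβ hf
  choose N hN using hp
  obtain ⟨t, -, ht⟩ := isCompact_univ.elim_nhds_subcover
    (fun z : UnitSpace β => {z' | Agree (N z) z' z}) fun z _ => agree_eventually hβ hf z (N z)
  refine ⟨t.sup N, fun z => ?_⟩
  obtain ⟨w, hw, hz⟩ := Set.mem_iUnion₂.1 (ht (Set.mem_univ z))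
  exact hN w _ (Finset.le_sup hw) z hz

lemma continuous_shiftMap : Continuous (shiftMap β) := by
  refine Continuous.subtype_mk (Continuous.prodMk ?_ ?_) _
  · exact continuous_pi fun n => continuous_lab (n + 1)
  · exact continuous_pi fun n => continuous_ver (n + 1)

lemma eventually_injOn_iterate (hβ : 1 < β) (hf : (remSet β).Finite) (k : ℕ) (z : UnitSpace β) :
    ∃ V ∈ 𝓝 z, Set.InjOn (shiftMap β)^[k] V :=
  ⟨_, agree_eventually hβ hf z k, fun _ hw _ hw' h =>
    eq_of_iterate (fun i hi => (hw.1 i hi).trans (hw'.1 i hi).symm) h⟩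

end UnitSpace

/-! ### The topological full group of a map -/

section FullGroup

open Topology Filter

variable {X : Type} [TopologicalSpace X] {s : X → X}

/-- `τ` is locally given by `s^k (τ x) = s^l x`. -/
def IsLocallyOrbital (s : X → X) (τ : X ≃ₜ X) : Prop :=
  ∀ x, ∃ k l : ℕ, ∀ᶠ y in 𝓝 x, s^[k] (τ y) = s^[l] y

lemma IsLocallyOrbital.one : IsLocallyOrbital s (1 : X ≃ₜ X) :=
  fun _ => ⟨0, 0, Eventually.of_forall fun _ => rfl⟩

lemma IsLocallyOrbital.mul {τ τ' : X ≃ₜ X} (h : IsLocallyOrbital s τ)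
    (h' : IsLocallyOrbital s τ') : IsLocallyOrbital s (τ * τ') := by
  intro x
  obtain ⟨k', l', h1⟩ := h' x
  obtain ⟨k, l, h2⟩ := h (τ' x)
  refine ⟨k' + k, l + l', ?_⟩
  filter_upwards [h1, τ'.continuous.continuousAt.eventually h2] with y hy1 hy2
  change s^[k' + k] (τ (τ' y)) = _
  rw [Function.iterate_add_apply, hy2, ← Function.iterate_add_apply, add_comm k',
    Function.iterate_add_apply, hy1, ← Function.iterate_add_apply]

lemma IsLocallyOrbital.inv {τ : X ≃ₜ X} (h : IsLocallyOrbital s τ) :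
    IsLocallyOrbital s τ⁻¹ := by
  intro x
  obtain ⟨k, l, h1⟩ := h (τ.symm x)
  refine ⟨l, k, ?_⟩
  filter_upwards [τ.symm.continuous.continuousAt.eventually h1] with y hy
  rw [τ.apply_symm_apply] at hy
  exact hy.symm

namespace DRGroupoid

/-- The generating sets form a basis: two of them through the same arrow have the same difference k
− l, and the relation with the smaller exponents implies the other. -/
lemma exists_basic_subset {W : Set (DRGroupoid s)} (hW : IsOpen W) {g : DRGroupoid s}
    (hg : g ∈ W) : ∃ (A B : Set X) (k l : ℕ), IsOpen A ∧ IsOpen B ∧ g ∈ basic s A k l B ∧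
      basic s A k l B ⊆ W := by
  induction hW with
  | basic W h =>
    obtain ⟨A, B, k, l, hA, hB, rfl⟩ := h
    exact ⟨A, B, k, l, hA, hB, hg, le_rfl⟩
  | univ =>
    obtain ⟨k, l, h1, h2⟩ := g.2
    exact ⟨Set.univ, Set.univ, k, l, isOpen_univ, isOpen_univ, ⟨trivial, trivial, h1, h2⟩,
      Set.subset_univ _⟩
  | inter W W' _ _ ih ih' =>
    obtain ⟨A, B, k, l, hA, hB, hg1, h⟩ := ih hg.1
    obtain ⟨A', B', k', l', hA', hB', hg1', h'⟩ := ih' hg.2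
    have key : ∀ (k l k' l' : ℕ), k ≤ k' → (k : ℤ) - l = k' - l' →
        ∀ (A A' B B' : Set X) (f : DRGroupoid s), f ∈ basic s (A ∩ A') k l (B ∩ B') →
          f ∈ basic s A k l B ∧ f ∈ basic s A' k' l' B' := by
      rintro k l k' l' hk he A A' B B' f ⟨hfA, hfB, hf1, hf2⟩
      refine ⟨⟨hfA.1, hfB.1, hf1, hf2⟩, hfA.2, hfB.2, hf1.trans he, ?_⟩
      obtain ⟨j, rfl⟩ := Nat.exists_eq_add_of_le' hk
      obtain rfl : l' = j + l := by omega
      rw [Function.iterate_add_apply, hf2, ← Function.iterate_add_apply]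
    have he : (k : ℤ) - l = k' - l' := hg1.2.2.1.symm.trans hg1'.2.2.1
    rcases le_total k k' with hk | hk
    · refine ⟨A ∩ A', B ∩ B', k, l, hA.inter hA', hB.inter hB',
        ⟨⟨hg1.1, hg1'.1⟩, ⟨hg1.2.1, hg1'.2.1⟩, hg1.2.2⟩, fun f hf => ?_⟩
      have := key k l k' l' hk he A A' B B' f hf
      exact ⟨h this.1, h' this.2⟩
    · refine ⟨A' ∩ A, B' ∩ B, k', l', hA'.inter hA, hB'.inter hB,
        ⟨⟨hg1'.1, hg1.1⟩, ⟨hg1'.2.1, hg1.2.1⟩, hg1'.2.2⟩, fun f hf => ?_⟩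
      have := key k' l' k l hk he.symm A' A B' B f hf
      exact ⟨h this.2, h' this.1⟩
  | sUnion S _ ih =>
    obtain ⟨W, hW, hgW⟩ := hg
    obtain ⟨A, B, k, l, hA, hB, hg1, h⟩ := ih W hW hgW
    exact ⟨A, B, k, l, hA, hB, hg1, h.trans (Set.subset_sUnion_of_mem hW)⟩

lemma isOpen_basic {A B : Set X} (hA : IsOpen A) (hB : IsOpen B) (k l : ℕ) :
    IsOpen (basic s A k l B) :=
  TopologicalSpace.isOpen_generateFrom_of_mem ⟨A, B, k, l, hA, hB, rfl⟩

lemma continuous_source : Continuous (source : DRGroupoid s → X) := by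
  rw [continuous_def]
  intro B hB
  rw [isOpen_iff_mem_nhds]
  intro g hg
  obtain ⟨k, l, h1, h2⟩ := g.2
  exact Filter.mem_of_superset ((isOpen_basic isOpen_univ hB k l).mem_nhds ⟨trivial, hg, h1, h2⟩)
    fun f hf => hf.2.1

end DRGroupoid

open DRGroupoid

/-- Removing a basic neighbourhood of the arrow over x from the compact set U leaves a compact set
whose sources avoid x. Hence all arrows over points near x use the same exponents. -/
lemma IsLocallyOrbital.of_mem [T2Space X] {τ : X ≃ₜ X} (h : τ ∈ topologicalFullGroup s) :
    IsLocallyOrbital s τ := by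
  obtain ⟨U, hUc, hUo, -, hinj, -, hsurj, hτ⟩ := h
  intro x
  obtain ⟨g, hgU, rfl⟩ : x ∈ source '' U := hsurj ▸ Set.mem_univ x
  obtain ⟨A, B, k, l, hA, hB, hg, hsub⟩ := exists_basic_subset hUo hgU
  refine ⟨k, l, ?_⟩
  have hc : IsClosed (source '' (U \ basic s A k l B)) :=
    ((hUc.diff (isOpen_basic hA hB k l)).image continuous_source).isClosed
  have hx : g.source ∈ (source '' (U \ basic s A k l B))ᶜ := by
    rintro ⟨f, hf, he⟩
    exact hf.2 (hinj hf.1 hgU he ▸ hg)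
  filter_upwards [hc.isOpen_compl.mem_nhds hx] with y hy
  obtain ⟨f, hfU, rfl⟩ : y ∈ source '' U := hsurj ▸ Set.mem_univ y
  have hf : f ∈ basic s A k l B := by
    by_contra hf
    exact hy ⟨f, ⟨hfU, hf⟩, rfl⟩
  rw [hτ f hfU]
  exact hf.2.2.2

/-- The converse direction; `d` selects the exponents in a locally constant way. -/
lemma mem_topologicalFullGroup [CompactSpace X] (hs : Continuous s)
    (hinj : ∀ (k : ℕ) (x : X), ∃ V ∈ 𝓝 x, Set.InjOn s^[k] V) {τ : X ≃ₜ X} (d : X → ℕ × ℕ)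
    (hd : ∀ x, ∀ᶠ y in 𝓝 x, d y = d x) (h : ∀ x, s^[(d x).1] (τ x) = s^[(d x).2] x) :
    τ ∈ topologicalFullGroup s := by
  let φ : X → DRGroupoid s := fun x =>
    ⟨(τ x, ((d x).1 : ℤ) - (d x).2, x), (d x).1, (d x).2, rfl, h x⟩
  have hφs : ∀ x, (φ x).source = x := fun x => rfl
  have hφr : ∀ x, (φ x).range = τ x := fun x => rfl
  have hφ : Continuous φ := by
    refine continuous_generateFrom_iff.2 ?_
    rintro _ ⟨A, B, k, l, hA, hB, rfl⟩
    rw [isOpen_iff_mem_nhds]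
    rintro x ⟨hxA, hxB, hx1, hx2⟩
    have hx1' : ((d x).1 : ℤ) - (d x).2 = k - l := hx1
    have hx2' : s^[k] (τ x) = s^[l] x := hx2
    have hev : ∀ᶠ y in 𝓝 x, s^[k] (τ y) = s^[l] y := by
      -- The differences of exponents agree. Larger exponents follow by applying s; for smaller ones
      -- the extra j shifts are cancelled by local injectivity.
      rcases le_total (d x).1 k with hk | hk
      · filter_upwards [hd x] with y hy
        obtain ⟨j, hj⟩ := Nat.exists_eq_add_of_le' hk
        have hl : l = j + (d x).2 := by omega
        rw [hj, hl, Function.iterate_add_apply, Function.iterate_add_apply, ← hy, h y]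
      · obtain ⟨j, hj⟩ := Nat.exists_eq_add_of_le' hk
        have hl : (d x).2 = j + l := by omega
        obtain ⟨V, hV, hVinj⟩ := hinj j (s^[l] x)
        have h1 : ∀ᶠ y in 𝓝 x, s^[l] y ∈ V := (hs.iterate l).continuousAt.eventually hV
        have h2 : ∀ᶠ y in 𝓝 x, s^[k] (τ y) ∈ V :=
          ((hs.iterate k).comp τ.continuous).continuousAt.eventually
            (by
              change V ∈ 𝓝 (s^[k] (τ x))
              rwa [hx2'])
        filter_upwards [h1, h2, hd x] with y hy1 hy2 hy
        refine hVinj hy2 hy1 ?_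
        have := h y
        rwa [hy, hj, hl, Function.iterate_add_apply, Function.iterate_add_apply] at this
    filter_upwards [hev, hd x, τ.continuous.continuousAt.eventually (hA.mem_nhds hxA),
      hB.mem_nhds hxB] with y hy1 hy2 hy3 hy4
    refine ⟨hy3, hy4, ?_, hy1⟩
    change ((d y).1 : ℤ) - (d y).2 = k - l
    rw [hy2, hx1']
  refine ⟨Set.range φ, isCompact_range hφ, ?_, ?_, ?_, ?_, ?_, ?_⟩
  -- Openness of the range: an arrow near `φ x` has the same exponents, and local injectivity of the
  -- iterate identifies its range with the image of its source under τ.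
  · rw [isOpen_iff_mem_nhds]
    rintro _ ⟨x, rfl⟩
    obtain ⟨V, hV, hVinj⟩ := hinj (d x).1 (τ x)
    obtain ⟨A, hAV, hA, hxA⟩ := mem_nhds_iff.1 hV
    obtain ⟨B, hBd, hB, hxB⟩ := mem_nhds_iff.1
      ((hd x).and (τ.continuous.continuousAt.eventually (hA.mem_nhds hxA)))
    refine Filter.mem_of_superset ((isOpen_basic hA hB (d x).1 (d x).2).mem_nhds
      ⟨hxA, hxB, rfl, h x⟩) ?_
    rintro f ⟨hf1, hf2, hf3, hf4⟩
    obtain ⟨hd', hτA⟩ := hBd hf2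
    refine ⟨f.source, ?_⟩
    have hr : τ f.source = f.range := by
      refine hVinj (hAV hτA) (hAV hf1) ?_
      rw [hf4, ← hd', h]
    have hc : ((d f.source).1 : ℤ) - (d f.source).2 = f.1.2.1 := by rw [hd', hf3]
    exact Subtype.ext (Prod.ext hr (Prod.ext hc rfl))
  · rintro _ ⟨x, rfl⟩ _ ⟨y, rfl⟩ hxy
    rw [hφr, hφr] at hxy
    rw [τ.injective hxy]
  · rintro _ ⟨x, rfl⟩ _ ⟨y, rfl⟩ hxy
    rw [hφs, hφs] at hxy
    rw [hxy]
  · refine Set.eq_univ_of_forall fun x => ⟨φ (τ.symm x), ⟨_, rfl⟩, ?_⟩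
    rw [hφr, τ.apply_symm_apply]
  · exact Set.eq_univ_of_forall fun x => ⟨φ x, ⟨_, rfl⟩, rfl⟩
  · rintro _ ⟨x, rfl⟩
    rfl

end FullGroup

open Topology Filter

/-! ### Right points -/

/-- The intervals [low ρ, ρ), ρ a remainder, are pairwise disjoint. -/
lemma threshold_unique {β : ℝ} (hf : (remSet β).Finite) {ρ ρ' s : ℝ} (h : ρ ∈ remSet β)
    (h' : ρ' ∈ remSet β) (h1 : low β ρ ≤ s) (h2 : s < ρ) (h1' : low β ρ' ≤ s) (h2' : s < ρ') :
    ρ = ρ' := by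
  rcases lt_trichotomy ρ ρ' with hlt | heq | hlt
  · linarith [le_low hf h hlt]
  · exact heq
  · linarith [le_low hf h' hlt]

lemma exists_threshold_gt {β : ℝ} (hβ : 1 < β) (hf : (remSet β).Finite) {s : ℝ} (h0 : 0 ≤ s)
    (h1 : s < 1) : ∃ ρ, HasThreshold β (fun μ => decide (s < weight β 1 μ)) ρ ∧
      low β ρ ≤ s ∧ s < ρ := by
  have hne : {r | r ∈ remSet β ∧ s < r}.Nonempty := ⟨1, one_mem_remSet β, h1⟩
  have hfin : {r | r ∈ remSet β ∧ s < r}.Finite := hf.subset fun r hr => hr.1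
  have h := hne.csInf_mem hfin
  refine ⟨_, ⟨h.1, fun μ => ?_⟩, ?_, h.2⟩
  · rw [decide_eq_true_iff]
    constructor
    · intro hs
      exact csInf_le hfin.bddBelow ⟨weight_mem_remSet hβ (one_mem_remSet β) (h0.trans_lt hs), hs⟩
    · intro hs
      exact h.2.trans_le hs
  · rcases (low_spec hf (sInf {r | r ∈ remSet β ∧ s < r})).1 with h2 | h2
    · rwa [h2]
    · by_contra! hlt
      exact absurd (csInf_le hfin.bddBelow ⟨h2.1, hlt⟩) (not_le.2 h2.2)

namespace UnitSpace

variable {β : ℝ}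

/-- The path of the expansion of `t`, approached from the right. -/
def lift (hβ : 1 < β) (hf : (remSet β).Finite) (t : Set.Ico (0 : ℝ) 1) : UnitSpace β :=
  -- The strict inequality selects the limit from the right: at a remainder, the orbit point is
  -- assigned to the interval that begins there.
  ⟨(digits β t, fun n μ => decide ((betaMap β)^[n] (t : ℝ) < weight β 1 μ)), by
    refine ⟨fun n => ?_, fun n => ⟨?_, fun μ => ?_⟩⟩
    · obtain ⟨ρ, h, -⟩ := exists_threshold_gt hβ hf (iter_nonneg t.2.1 n) (iter_lt_one t.2.2 n)
      exact h.isVertex hβ hf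
    · have h1 := iter_succ hβ t.2.1 n
      have h2 : (betaMap β)^[n] (t : ℝ) < 1 := iter_lt_one t.2.2 n
      have h3 := mul_lt_mul_of_pos_left h2 (by linarith : 0 < β)
      refine decide_eq_true (lt_min (iter_lt_one t.2.2 _) ?_)
      rw [h1]
      linarith
    · refine decide_eq_decide.2 ?_
      have h1 := iter_succ hβ t.2.1 n
      rw [weight_concat, act, lt_min_iff, and_iff_right (iter_lt_one t.2.2 (n + 1)), h1,
        sub_lt_sub_iff_right]
      exact (mul_lt_mul_iff_right₀ (by linarith : 0 < β)).symm⟩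

lemma lift_th (hβ : 1 < β) (hf : (remSet β).Finite) (t : Set.Ico (0 : ℝ) 1) (n : ℕ) :
    low β ((lift hβ hf t).th n) ≤ (betaMap β)^[n] t ∧
      (betaMap β)^[n] (t : ℝ) < (lift hβ hf t).th n := by
  obtain ⟨ρ, h, h1⟩ := exists_threshold_gt hβ hf (iter_nonneg t.2.1 n) (iter_lt_one t.2.2 n)
  have : (lift hβ hf t).th n = ρ := h.thr_eq hβ
  rwa [this]

lemma lift_lsum (hβ : 1 < β) (hf : (remSet β).Finite) (t : Set.Ico (0 : ℝ) 1) (n : ℕ) :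
    (t : ℝ) = (lift hβ hf t).lsum n + (betaMap β)^[n] t / β ^ n := digits_sum hβ t.2.1 n

lemma coding_lift (hβ : 1 < β) (hf : (remSet β).Finite) (t : Set.Ico (0 : ℝ) 1) :
    coding (lift hβ hf t) = t := by
  have hb : (0 : ℝ) < β := by linarith
  refine tendsto_nhds_unique ((lift hβ hf t).tendsto_lsum hβ hf) ?_
  have h : Tendsto (fun n => (betaMap β)^[n] (t : ℝ) / β ^ n) atTop (𝓝 0) := by
    refine squeeze_zero (fun n => div_nonneg (iter_nonneg t.2.1 n) (by positivity)) (fun n => ?_)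
      (tendsto_pow_atTop_nhds_zero_of_lt_one (by positivity : 0 ≤ 1 / β) ((div_lt_one hb).2 hβ))
    rw [div_pow, one_pow]
    gcongr
    exact (iter_lt_one t.2.2 n).le
  have h2 := h.const_sub (t : ℝ)
  rw [sub_zero] at h2
  refine h2.congr fun n => ?_
  have := lift_lsum hβ hf t n
  linarith

lemma coding_iterate_lift (hβ : 1 < β) (hf : (remSet β).Finite) (t : Set.Ico (0 : ℝ) 1) (n : ℕ) :
    coding ((shiftMap β)^[n] (lift hβ hf t)) = (betaMap β)^[n] t := by
  have hb : (0 : ℝ) < β ^ n := pow_pos (by linarith) n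
  have h1 := coding_eq hβ hf (lift hβ hf t) n
  have h2 := lift_lsum hβ hf t n
  rw [coding_lift] at h1
  have h3 : coding ((shiftMap β)^[n] (lift hβ hf t)) / β ^ n = (betaMap β)^[n] t / β ^ n := by
    linarith
  exact (div_left_inj' hb.ne').1 h3

/-- Pull y back along the inverse branches given by the labels of z; `th_step` and `low_step` keep
each preimage in the interval of the corresponding vertex. -/
lemma exists_lift_agree (hβ : 1 < β) (hf : (remSet β).Finite) (z : UnitSpace β) (n : ℕ) {y : ℝ}
    (h1 : low β (z.th n) ≤ y) (h2 : y < z.th n) :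
    ∃ t : Set.Ico (0 : ℝ) 1, (t : ℝ) = z.lsum n + y / β ^ n ∧ (betaMap β)^[n] (t : ℝ) = y ∧
      Agree n (lift hβ hf t) z := by
  have hb : (0 : ℝ) < β := by linarith
  have hver : ∀ (n : ℕ) (t : Set.Ico (0 : ℝ) 1), low β (z.th n) ≤ (betaMap β)^[n] t →
      (betaMap β)^[n] (t : ℝ) < z.th n → (lift hβ hf t).ver n = z.ver n := by
    intro n t h1 h2
    have h3 := lift_th hβ hf t n
    exact ver_congr hβ hf (threshold_unique hf (th_mem hβ hf _ _) (th_mem hβ hf _ _)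
      h3.1 h3.2 h1 h2)
  induction n generalizing y with
  | zero =>
    refine ⟨⟨y, (low_nonneg hf _).trans h1, h2.trans_le (remSet_le_one (z.th_mem hβ hf 0))⟩,
      by simp [lsum], rfl, by simp, hver 0 _ h1 h2⟩
  | succ n ih =>
    have h3 := z.th_step hβ hf n
    have h4 := z.low_step hβ hf n
    have h5 : 0 ≤ y := (low_nonneg hf _).trans h1
    have h6 : y < 1 := h2.trans_le (remSet_le_one (z.th_mem hβ hf (n + 1)))
    obtain ⟨t, ht1, ht2, ht3⟩ := ih (y := (y + z.lab n) / β)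
      ((le_div_iff₀ hb).2 (by linarith)) ((div_lt_iff₀ hb).2 (by linarith))
    have hm : β * (betaMap β)^[n] (t : ℝ) = y + z.lab n := by
      rw [ht2]
      field_simp
    have hd : digits β t n = z.lab n := by
      rw [digits, hm, Nat.floor_add_natCast h5, Nat.floor_eq_zero.2 h6, zero_add]
    have hit : (betaMap β)^[n + 1] (t : ℝ) = y := by
      rw [iter_succ hβ t.2.1, hm, hd]
      ring
    refine ⟨t, ?_, hit, fun i hi => ?_, hver (n + 1) t (hit.symm ▸ h1) (hit.symm ▸ h2)⟩
    · rw [ht1, lsum_succ]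
      field_simp
      ring
    · rcases Nat.lt_succ_iff_lt_or_eq.1 hi with hi | rfl
      · exact ht3.1 i hi
      · exact hd

lemma Agree.lsum_eq {n : ℕ} {z z' : UnitSpace β} (h : Agree n z z') : z.lsum n = z'.lsum n :=
  Finset.sum_congr rfl fun i hi => by rw [h.1 i (Finset.mem_range.1 hi)]

lemma Agree.th_eq {n : ℕ} {z z' : UnitSpace β} (h : Agree n z z') : z.th n = z'.th n := by
  rw [th, h.2, th]

lemma lift_of_agree (hβ : 1 < β) (hf : (remSet β).Finite) {z : UnitSpace β} {n : ℕ}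
    {t : Set.Ico (0 : ℝ) 1} (h : Agree n (lift hβ hf t) z) :
    (t : ℝ) = z.lsum n + (betaMap β)^[n] t / β ^ n ∧ low β (z.th n) ≤ (betaMap β)^[n] t ∧
      (betaMap β)^[n] (t : ℝ) < z.th n := by
  rw [← h.lsum_eq, ← h.th_eq]
  exact ⟨lift_lsum hβ hf t n, lift_th hβ hf t n⟩

/-- The cylinder of `z` at level `n` corresponds to an interval. -/
lemma agree_lift_iff (hβ : 1 < β) (hf : (remSet β).Finite) (z : UnitSpace β) (n : ℕ)
    (t : Set.Ico (0 : ℝ) 1) : Agree n (lift hβ hf t) z ↔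
      z.lsum n + low β (z.th n) / β ^ n ≤ t ∧ (t : ℝ) < z.lsum n + z.th n / β ^ n := by
  have hb : (0 : ℝ) < β ^ n := pow_pos (by linarith) n
  constructor
  · intro h
    obtain ⟨h1, h2, h3⟩ := lift_of_agree hβ hf h
    rw [h1]
    constructor <;> gcongr
  · rintro ⟨h1, h2⟩
    obtain ⟨t', h3, -, h4⟩ := exists_lift_agree hβ hf z n (y := (t - z.lsum n) * β ^ n)
      ((div_le_iff₀ hb).1 (by linarith)) ((lt_div_iff₀ hb).1 (by linarith))
    have : t' = t := by
      refine Subtype.ext ?_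
      rw [h3]
      field_simp
      ring
    rwa [this] at h4

/-- `z` is the limit from the right at its value. -/
def IsRight (z : UnitSpace β) : Prop := ∀ n, coding ((shiftMap β)^[n] z) < z.th n

lemma coding_iterate_le (hβ : 1 < β) (hf : (remSet β).Finite) (z : UnitSpace β) (n : ℕ) :
    coding ((shiftMap β)^[n] z) ≤ z.th n := by
  have := coding_le_th hβ hf ((shiftMap β)^[n] z)
  rwa [th_iterate] at this

lemma low_le_coding_iterate (hβ : 1 < β) (hf : (remSet β).Finite) (z : UnitSpace β) (n : ℕ) :
    low β (z.th n) ≤ coding ((shiftMap β)^[n] z) := by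
  have := low_le_coding hβ hf ((shiftMap β)^[n] z)
  rwa [th_iterate] at this

/-- A path that sits at the right end of its interval once stays there: equality propagates through
`th_step`. -/
lemma coding_eq_th_of_le (hβ : 1 < β) (hf : (remSet β).Finite) {z : UnitSpace β} {m n : ℕ}
    (hmn : m ≤ n) (h : coding ((shiftMap β)^[m] z) = z.th m) :
    coding ((shiftMap β)^[n] z) = z.th n := by
  induction n, hmn using Nat.le_induction with
  | base => exact h
  | succ n _ ih =>
    have h1 := z.coding_step hβ hf n
    have h2 := z.th_step hβ hf n
    have h3 := z.coding_iterate_le hβ hf (n + 1)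
    rw [ih] at h1
    linarith

lemma isRight_lift (hβ : 1 < β) (hf : (remSet β).Finite) (t : Set.Ico (0 : ℝ) 1) :
    IsRight (lift hβ hf t) := fun n => by
  rw [coding_iterate_lift]
  exact (lift_th hβ hf t n).2

lemma isRight_iterate_iff (hβ : 1 < β) (hf : (remSet β).Finite) (z : UnitSpace β) (n : ℕ) :
    IsRight ((shiftMap β)^[n] z) ↔ IsRight z := by
  constructor
  · intro h m
    refine lt_of_le_of_ne (coding_iterate_le hβ hf z m) fun he => ?_
    have h1 := coding_eq_th_of_le hβ hf (Nat.le_add_left m n) he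
    have h2 := h m
    rw [← Function.iterate_add_apply, th_iterate, add_comm m n] at h2
    exact h2.ne h1
  · intro h m
    rw [← Function.iterate_add_apply, th_iterate, add_comm m n]
    exact h _

lemma agree_lift_coding (hβ : 1 < β) (hf : (remSet β).Finite) {z : UnitSpace β} {n : ℕ}
    (h : coding ((shiftMap β)^[n] z) < z.th n) :
    ∃ t : Set.Ico (0 : ℝ) 1, (t : ℝ) = coding z ∧ Agree n (lift hβ hf t) z := by
  obtain ⟨t, h1, -, h2⟩ := exists_lift_agree hβ hf z n (low_le_coding_iterate hβ hf z n) h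
  exact ⟨t, by rw [h1, ← coding_eq hβ hf], h2⟩

lemma IsRight.coding_mem (hβ : 1 < β) (hf : (remSet β).Finite) {z : UnitSpace β}
    (h : IsRight z) : coding z ∈ Set.Ico (0 : ℝ) 1 := by
  obtain ⟨t, ht, -⟩ := agree_lift_coding hβ hf (h 0)
  exact ht ▸ t.2

lemma eq_of_agree {z z' : UnitSpace β} (h : ∀ n, Agree n z z') : z = z' :=
  ext' (fun n => (h (n + 1)).1 n (by omega)) fun n => (h n).2

lemma IsRight.lift_coding (hβ : 1 < β) (hf : (remSet β).Finite) {z : UnitSpace β}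
    (h : IsRight z) : lift hβ hf ⟨coding z, h.coding_mem hβ hf⟩ = z := by
  refine eq_of_agree fun n => ?_
  obtain ⟨t, ht, ha⟩ := agree_lift_coding hβ hf (h n)
  have : t = ⟨coding z, h.coding_mem hβ hf⟩ := Subtype.ext ht
  rwa [this] at ha

/-- Every cylinder contains the lift of the left end of its interval. -/
lemma dense_range_lift (hβ : 1 < β) (hf : (remSet β).Finite) : DenseRange (lift hβ hf) := by
  intro z
  rw [mem_closure_iff_nhds]
  intro V hV
  obtain ⟨n, hn⟩ := exists_agree_subset hV
  obtain ⟨t, -, -, ht⟩ := exists_lift_agree hβ hf z n le_rfl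
    (low_lt hf (remSet_pos (z.th_mem hβ hf n)))
  exact ⟨lift hβ hf t, hn _ ht, t, rfl⟩

/-! ### Prefixing words -/

lemma cat_concat (μ : List ℕ) (a : ℕ) (x : ℕ → ℕ) : cat (μ ++ [a]) x = cat μ (cat [a] x) := by
  funext n
  rcases lt_or_ge n μ.length with h | h
  · simp [cat, List.getElem?_append_left h, h]
  · obtain ⟨j, rfl⟩ := Nat.exists_eq_add_of_le h
    rw [cat_add]
    cases j with
    | zero => simp [cat]
    | succ j =>
      have h1 := cat_add (μ ++ [a]) x j
      have h2 := cat_add [a] x j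
      rw [List.length_append, List.length_singleton, add_assoc, add_comm 1 j] at h1
      rw [List.length_singleton, add_comm 1 j] at h2
      rw [h1, h2]

lemma exists_cons {z : UnitSpace β} {a : ℕ} (h : z.ver 0 [a] = true) :
    ∃ w : UnitSpace β, w.lab 0 = a ∧ shiftMap β w = z := by
  -- The new initial vertex is forced by the edge relation: its past consists of the μ for which μa
  -- is in the past of the old one.
  refine ⟨⟨(fun n => Nat.casesOn n a z.lab,
    fun n => Nat.casesOn n (fun μ => z.ver 0 (μ ++ [a])) z.ver), ?_, ?_⟩, rfl, rfl⟩
  · rintro (_ | n)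
    · intro l
      obtain ⟨x, hx, hu⟩ := z.isVertex 0 (l + 1)
      refine ⟨cat [a] x, (hu [a] (by simp)).1 h, fun μ hμ => ?_⟩
      rw [← cat_concat]
      exact hu _ (by simpa using hμ)
    · exact z.isVertex n
  · rintro (_ | n)
    · exact ⟨h, fun μ => rfl⟩
    · exact z.2.2 n

lemma exists_prepend (hβ : 1 < β) (hf : (remSet β).Finite) {z : UnitSpace β} (ν : List ℕ)
    (h : z.ver 0 ν = true) :
    ∃ w : UnitSpace β, pre w.lab ν.length = ν ∧ (shiftMap β)^[ν.length] w = z := by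
  induction ν with
  | nil => exact ⟨z, rfl, rfl⟩
  | cons a ν ih =>
    have h1 : z.ver 0 ν = true := by
      rw [ver_eq_true_iff hβ hf] at h ⊢
      exact h.trans (weight_mono hβ (act_le_one β 1 a) ν)
    obtain ⟨w, hw1, hw2⟩ := ih h1
    have h2 : w.ver 0 [a] = true := by
      rw [w.ver_pre 0 ν.length]
      simp only [zero_add]
      rw [hw1]
      rw [← hw2, ver_iterate] at h
      exact h
    obtain ⟨w', h3, rfl⟩ := exists_cons h2
    refine ⟨w', ?_, ?_⟩
    · rw [List.length_cons, add_comm, pre_add]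
      have h4 : (fun i => w'.lab (1 + i)) = (shiftMap β w').lab := by
        funext i
        exact congrArg w'.lab (add_comm 1 i)
      rw [h4, hw1]
      simp [pre, h3]
    · rw [List.length_cons, Function.iterate_succ_apply, hw2]

/-! ### Locally orbital homeomorphisms of the unit space -/

lemma exists_uniform_orbital (hβ : 1 < β) (hf : (remSet β).Finite)
    {τ : UnitSpace β ≃ₜ UnitSpace β} (h : IsLocallyOrbital (shiftMap β) τ) :
    ∃ m, ∀ z, ∃ k, ∀ z', Agree m z' z → (∀ i < k, (τ z').lab i = (τ z).lab i) ∧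
      (shiftMap β)^[k] (τ z') = (shiftMap β)^[m] z' := by
  refine exists_uniform hβ hf fun z₀ => ?_
  obtain ⟨k, l, h1⟩ := h z₀
  obtain ⟨n₀, h2⟩ := (eventually_iff_agree hβ hf).1 h1
  obtain ⟨n₁, h3⟩ := (eventually_iff_agree hβ hf).1
    (τ.continuous.continuousAt.eventually (agree_eventually hβ hf (τ z₀) k))
  -- To use one exponent m everywhere, m − l further shifts are applied to both sides, so k becomes
  -- k + (m − l).
  refine ⟨max (max n₀ n₁) l, fun m hm z hz => ⟨k + (m - l), fun z' hz' => ?_⟩⟩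
  have hz0 : Agree (max (max n₀ n₁) l) z' z₀ := (hz'.mono hm).trans hz
  have e : m = l + (m - l) := by omega
  have h4 := h2 z (hz.mono (by omega))
  have h5 := h2 z' (hz0.mono (by omega))
  have h6 := h3 z (hz.mono (by omega))
  have h7 := h3 z' (hz0.mono (by omega))
  constructor
  · refine (Agree.of_iterate (h7.trans h6.symm).1 (n := m - l) ?_).1
    rw [h4, h5]
    rw [e] at hz'
    exact hz'.iterate
  · rw [add_comm, Function.iterate_add_apply, h5, ← Function.iterate_add_apply, add_comm, ← e]

lemma mem_topologicalFullGroup_iff (hβ : 1 < β) (hf : (remSet β).Finite)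
    {τ : UnitSpace β ≃ₜ UnitSpace β} :
    τ ∈ topologicalFullGroup (shiftMap β) ↔ IsLocallyOrbital (shiftMap β) τ := by
  refine ⟨IsLocallyOrbital.of_mem, fun h => ?_⟩
  have := compactSpace hβ hf
  obtain ⟨m, hm⟩ := exists_uniform_orbital hβ hf h
  -- The admissible exponents depend only on the cylinder at level m; their minimum is thus a
  -- locally constant choice.
  let K : UnitSpace β → Set ℕ := fun z =>
    {k | ∀ z', Agree m z' z → (shiftMap β)^[k] (τ z') = (shiftMap β)^[m] z'}
  have hK : ∀ z z', Agree m z' z → K z' ⊆ K z := fun z z' hz k hk w hw =>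
    hk w (hw.trans hz.symm)
  have hne : ∀ z, sInf (K z) ∈ K z := fun z => by
    obtain ⟨k, hk⟩ := hm z
    exact Nat.sInf_mem ⟨k, fun z' hz' => (hk z' hz').2⟩
  refine mem_topologicalFullGroup continuous_shiftMap (eventually_injOn_iterate hβ hf)
    (fun z => (sInf (K z), m)) (fun z => ?_) fun z => hne z z (Agree.refl m z)
  filter_upwards [agree_eventually hβ hf z m] with z' hz'
  rw [(hK z z' hz').antisymm (hK z' z hz'.symm)]

lemma isRight_apply_iff (hβ : 1 < β) (hf : (remSet β).Finite)
    {τ : UnitSpace β ≃ₜ UnitSpace β} (h : IsLocallyOrbital (shiftMap β) τ) (z : UnitSpace β) :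
    IsRight (τ z) ↔ IsRight z := by
  obtain ⟨k, l, h1⟩ := h z
  rw [← isRight_iterate_iff hβ hf (τ z) k, h1.self_of_nhds, isRight_iterate_iff hβ hf]

end UnitSpace

/-! ### The faithful action of the full group on [0,1) -/

open UnitSpace

/-- The homeomorphisms of the unit space that are locally orbital. -/
def fullGroup (β : ℝ) : Subgroup (UnitSpace β ≃ₜ UnitSpace β) where
  carrier := {τ | IsLocallyOrbital (shiftMap β) τ}
  one_mem' := IsLocallyOrbital.one
  mul_mem' := IsLocallyOrbital.mul
  inv_mem' := IsLocallyOrbital.inv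

/-- The right points correspond to the points of `[0,1)`. -/
def liftEquiv {β : ℝ} (hβ : 1 < β) (hf : (remSet β).Finite) :
    Set.Ico (0 : ℝ) 1 ≃ {z : UnitSpace β // IsRight z} where
  toFun t := ⟨lift hβ hf t, isRight_lift hβ hf t⟩
  invFun z := ⟨coding z.1, z.2.coding_mem hβ hf⟩
  left_inv t := Subtype.ext (coding_lift hβ hf t)
  right_inv z := Subtype.ext (z.2.lift_coding hβ hf)

/-- The action of the full group on `[0,1)`. -/
def realize {β : ℝ} (hβ : 1 < β) (hf : (remSet β).Finite) :
    fullGroup β →* Equiv.Perm (Set.Ico (0 : ℝ) 1) where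
  toFun τ := (liftEquiv hβ hf).trans (((τ : UnitSpace β ≃ₜ UnitSpace β).toEquiv.subtypeEquiv
    fun z => (isRight_apply_iff hβ hf τ.2 z).symm).trans (liftEquiv hβ hf).symm)
  map_one' := Equiv.ext fun t => (liftEquiv hβ hf).symm_apply_apply t
  map_mul' τ τ' := Equiv.ext fun t => by
    simp only [Equiv.trans_apply, Equiv.Perm.mul_apply, Equiv.apply_symm_apply]
    rfl

lemma lift_realize {β : ℝ} (hβ : 1 < β) (hf : (remSet β).Finite) (τ : fullGroup β)
    (t : Set.Ico (0 : ℝ) 1) : lift hβ hf (realize hβ hf τ t) =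
      (τ : UnitSpace β ≃ₜ UnitSpace β) (lift hβ hf t) :=
  congrArg Subtype.val ((liftEquiv hβ hf).apply_symm_apply
    ⟨τ.1 (lift hβ hf t), (isRight_apply_iff hβ hf τ.2 _).2 (isRight_lift hβ hf t)⟩)

lemma realize_apply {β : ℝ} (hβ : 1 < β) (hf : (remSet β).Finite) (τ : fullGroup β)
    (t : Set.Ico (0 : ℝ) 1) : (realize hβ hf τ t : ℝ) =
      coding ((τ : UnitSpace β ≃ₜ UnitSpace β) (lift hβ hf t)) := rfl

lemma realize_injective {β : ℝ} (hβ : 1 < β) (hf : (remSet β).Finite) :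
    Function.Injective (realize hβ hf) := by
  intro τ τ' h
  refine Subtype.ext (Homeomorph.ext fun z => congrFun (DenseRange.equalizer
    (dense_range_lift hβ hf) τ.1.continuous τ'.1.continuous (funext fun t => ?_)) z)
  change τ.1 (lift hβ hf t) = τ'.1 (lift hβ hf t)
  rw [← lift_realize, h, lift_realize]

lemma UnitSpace.finite_range_cylinder {β : ℝ} (hβ : 1 < β) (hf : (remSet β).Finite) (m : ℕ) :
    (Set.range fun z : UnitSpace β => (pre z.lab m, z.th m)).Finite := by
  have hl : {μ : List ℕ | μ.length = m ∧ ∀ a ∈ μ, a ≤ ⌊β⌋₊}.Finite := by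
    refine (List.finite_length_eq (Fin (⌊β⌋₊ + 1)) m).image (List.map Fin.val) |>.subset ?_
    rintro μ ⟨h1, h2⟩
    refine ⟨μ.pmap (fun a ha => ⟨a, ha⟩) fun a ha => Nat.lt_succ_of_le (h2 a ha),
      by simp [h1], ?_⟩
    simp [List.map_pmap]
  refine (hl.prod hf).subset ?_
  rintro _ ⟨z, rfl⟩
  refine ⟨⟨pre_length _ _, fun a ha => ?_⟩, z.th_mem hβ hf m⟩
  obtain ⟨i, rfl⟩ := (List.mem_ofFn' _ _).1 ha
  exact Nat.le_floor (z.lab_le hβ hf i)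

lemma exceptional_finite {β : ℝ} (hβ : 1 < β) (hf : (remSet β).Finite) (τ : fullGroup β) :
    {z : UnitSpace β | ¬ ∃ t : Set.Ico (0 : ℝ) 1, (t : ℝ) = coding z ∧
      (realize hβ hf τ t : ℝ) = coding (τ.1 z)}.Finite := by
  have hb : (0 : ℝ) < β := by linarith
  obtain ⟨m, hm⟩ := exists_uniform_orbital hβ hf τ.2
  -- Strictly below the right end of its level-m interval, z shares its level-m cylinder with the
  -- lift of its value, and τ replaces the same prefix in both.
  have hsub : {z : UnitSpace β | ¬ ∃ t : Set.Ico (0 : ℝ) 1, (t : ℝ) = coding z ∧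
      (realize hβ hf τ t : ℝ) = coding (τ.1 z)} ⊆
      {z | coding ((shiftMap β)^[m] z) = z.th m} := by
    intro z hz
    by_contra hne
    have hlt := lt_of_le_of_ne (coding_iterate_le hβ hf z m) hne
    obtain ⟨t, ht, ha⟩ := agree_lift_coding hβ hf hlt
    refine hz ⟨t, ht, ?_⟩
    obtain ⟨k, hk⟩ := hm z
    obtain ⟨h1, h2⟩ := hk _ ha
    have h3 := (hk z (Agree.refl m z)).2
    rw [realize_apply, coding_eq hβ hf _ k, coding_eq hβ hf (τ.1 z) k, h2, h3]
    have h4 : (τ.1 (lift hβ hf t)).lsum k = (τ.1 z).lsum k :=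
      Finset.sum_congr rfl fun i hi => by rw [h1 i (Finset.mem_range.1 hi)]
    have h5 := coding_eq hβ hf z m
    have h6 := coding_eq hβ hf (lift hβ hf t) m
    rw [coding_lift, ht, h5, ha.lsum_eq, add_right_inj,
      div_left_inj' (pow_pos hb m).ne'] at h6
    rw [h4, h6]
  refine Set.Finite.subset ?_ hsub
  refine Set.Finite.of_finite_image (f := fun z => (pre z.lab m, z.th m)) ?_ ?_
  · exact (finite_range_cylinder hβ hf m).subset (Set.image_subset_range _ _)
  · intro z hz z' hz' he
    obtain ⟨he1, he2⟩ := Prod.mk.inj he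
    rw [pre_eq_iff] at he1
    -- At a right end, β times the threshold equals the next threshold plus the label. As thresholds
    -- lie in (0,1], this determines the label and then the next threshold, so each cylinder has at
    -- most one such path.
    have key : ∀ n, z.th (m + n) = z'.th (m + n) ∧ ∀ i < m + n, z.lab i = z'.lab i := by
      intro n
      induction n with
      | zero => exact ⟨he2, he1⟩
      | succ n ih =>
        have hstep : ∀ w : UnitSpace β, coding ((shiftMap β)^[m] w) = w.th m →
            β * w.th (m + n) = w.th (m + n + 1) + w.lab (m + n) := by
          intro w hw
          have h1 := w.coding_step hβ hf (m + n)
          rwa [coding_eq_th_of_le hβ hf (by omega) hw,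
            coding_eq_th_of_le hβ hf (by omega) hw] at h1
        have h1 := hstep z hz
        have h2 := hstep z' hz'
        rw [ih.1] at h1
        have a1 := remSet_pos (z.th_mem hβ hf (m + n + 1))
        have a2 := remSet_pos (z'.th_mem hβ hf (m + n + 1))
        have b1 := remSet_le_one (z.th_mem hβ hf (m + n + 1))
        have b2 := remSet_le_one (z'.th_mem hβ hf (m + n + 1))
        have c1 : (z.lab (m + n) : ℝ) < z'.lab (m + n) + 1 := by linarith
        have c2 : (z'.lab (m + n) : ℝ) < z.lab (m + n) + 1 := by linarith
        have hlab : z.lab (m + n) = z'.lab (m + n) := by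
          norm_cast at c1 c2
          omega
        refine ⟨?_, fun i hi => ?_⟩
        · rw [hlab] at h1
          rw [← add_assoc]
          linarith
        · rcases Nat.lt_succ_iff_lt_or_eq.1 (show i < m + n + 1 from hi) with h | rfl
          · exact ih.2 i h
          · exact hlab
    refine eq_of_agree fun n => ⟨fun i hi => (key n).2 i (by omega), ?_⟩
    exact Agree.ver ⟨(key n).2, ver_congr hβ hf (key n).1⟩ (Nat.le_add_left n m)

/-! ### The minimal projections of `A_β` -/

/-- The function `E` is the indicator of the paths whose first vertex has threshold `ρ`. -/
def IsThresholdIndicator (β ρ : ℝ) (E : BoundedContinuousFunction (UnitSpace β) ℂ) : Prop :=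
  ρ ∈ remSet β ∧ ∀ z : UnitSpace β, E z = if z.th 0 = ρ then 1 else 0

lemma proj_apply {β : ℝ} (hβ : 1 < β) (hf : (remSet β).Finite) (μ : List ℕ) (z : UnitSpace β) :
    proj β μ z = if z.th 0 ≤ weight β 1 μ then 1 else 0 := by
  have h := ver_eq_true_iff hβ hf z 0 μ
  change (bif z.ver 0 μ then (1 : ℂ) else 0) = _
  cases hz : z.ver 0 μ
  · rw [hz] at h
    rw [if_neg (mt h.2 (by simp))]
    rfl
  · rw [if_pos (h.1 hz)]
    rfl

lemma proj_xiWord_apply {β : ℝ} (hβ : 1 < β) (hf : (remSet β).Finite) (n : ℕ) (z : UnitSpace β) :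
    proj β (xiWord β n) z = if z.th 0 ≤ qgRem β n then 1 else 0 := by
  rw [proj_apply hβ hf, weight_xiWord hβ]

lemma admissible_of_weight_pos {β : ℝ} (hβ : 1 < β) {ν : List ℕ} (h : 0 < weight β 1 ν) :
    ν ∈ admissible β := by
  refine ⟨cat ν (digits β 0), (cat_mem_betaShift_iff hβ).2
    (survives_digits hβ le_rfl one_pos h), 0, fun i hi => ?_⟩
  simp [cat, hi]

/-- The functions with equal values at z and z' form a closed star subalgebra, and it contains the
generators. -/
lemma algebraA_apply_eq {β : ℝ} (hβ : 1 < β) (hf : (remSet β).Finite)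
    {F : BoundedContinuousFunction (UnitSpace β) ℂ} (hF : F ∈ algebraA β) {z z' : UnitSpace β}
    (h : z.th 0 = z'.th 0) : F z = F z' := by
  let T : StarSubalgebra ℂ (BoundedContinuousFunction (UnitSpace β) ℂ) :=
    { carrier := {F | F z = F z'}
      mul_mem' := fun {F G} (hF : F z = F z') (hG : G z = G z') => by
        change F z * G z = F z' * G z'
        rw [hF, hG]
      add_mem' := fun {F G} (hF : F z = F z') (hG : G z = G z') => by
        change F z + G z = F z' + G z'
        rw [hF, hG]
      algebraMap_mem' := fun r => rfl
      star_mem' := fun {F} (hF : F z = F z') => by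
        change star (F z) = star (F z')
        rw [hF] }
  have hT : IsClosed (T : Set (BoundedContinuousFunction (UnitSpace β) ℂ)) :=
    isClosed_eq (continuous_eval_const z) (continuous_eval_const z')
  refine StarSubalgebra.topologicalClosure_minimal (StarAlgebra.adjoin_le ?_) hT hF
  rintro _ ⟨μ, -, rfl⟩
  change proj β μ z = proj β μ z'
  rw [proj_apply hβ hf, proj_apply hβ hf, h]

lemma proj_xiWord_mem {β : ℝ} (hβ : 1 < β) (n : ℕ) : proj β (xiWord β n) ∈ algebraA β :=
  StarSubalgebra.le_topologicalClosure _ (StarAlgebra.subset_adjoin _ _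
    ⟨_, admissible_of_weight_pos hβ (by rw [weight_xiWord hβ]; exact (qgRem_mem n).1), rfl⟩)

lemma exists_th_eq {β : ℝ} (hβ : 1 < β) (hf : (remSet β).Finite) {ρ : ℝ} (hρ : ρ ∈ remSet β) :
    ∃ z : UnitSpace β, z.th 0 = ρ := by
  have h1 := low_nonneg hf ρ
  have h2 := low_lt hf (remSet_pos hρ)
  have h3 := lift_th hβ hf ⟨low β ρ, h1, h2.trans_le (remSet_le_one hρ)⟩ 0
  exact ⟨_, threshold_unique hf (th_mem hβ hf _ 0) hρ h3.1 h3.2 le_rfl h2⟩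

/-- The indicator of a threshold is the difference of the prefix projections of two consecutive
remainders, or a single projection at the smallest one, where `low` has the default value 0. -/
lemma exists_thresholdIndicator {β : ℝ} (hβ : 1 < β) (hf : (remSet β).Finite) {ρ : ℝ}
    (hρ : ρ ∈ remSet β) : ∃ E ∈ algebraA β, IsThresholdIndicator β ρ E ∧
      ∃ p, qgRem β p = ρ ∧
        ((∃ q, qgRem β q = low β ρ ∧ E = proj β (xiWord β p) - proj β (xiWord β q)) ∨
          (low β ρ = 0 ∧ E = proj β (xiWord β p))) := by
  obtain ⟨p, rfl⟩ := hρ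
  have hlt := low_lt hf (qgRem_mem (β := β) p).1
  rcases (low_spec hf (qgRem β p)).1 with h | ⟨⟨q, hq⟩, h⟩
  · refine ⟨_, proj_xiWord_mem hβ p, ⟨⟨p, rfl⟩, fun z => ?_⟩, p, rfl, Or.inr ⟨h, rfl⟩⟩
    rw [proj_xiWord_apply hβ hf]
    have h1 := z.th_mem hβ hf 0
    refine if_congr ⟨fun h2 => h2.antisymm ?_, fun h2 => h2.le⟩ rfl rfl
    by_contra! h3
    have := le_low hf h1 h3
    linarith [remSet_pos h1]
  · refine ⟨_, sub_mem (proj_xiWord_mem hβ p) (proj_xiWord_mem hβ q), ⟨⟨p, rfl⟩, fun z => ?_⟩,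
      p, rfl, Or.inl ⟨q, hq, rfl⟩⟩
    rw [BoundedContinuousFunction.sub_apply, proj_xiWord_apply hβ hf, proj_xiWord_apply hβ hf, hq]
    have h1 := z.th_mem hβ hf 0
    rcases lt_trichotomy (z.th 0) (qgRem β p) with h2 | h2 | h2
    · rw [if_pos h2.le, if_pos (le_low hf h1 h2), if_neg h2.ne, sub_self]
    · rw [if_pos h2.le, if_neg (by rw [h2]; exact not_le.2 h), if_pos h2, sub_zero]
    · rw [if_neg (not_le.2 h2), if_neg (not_le.2 (h.trans h2)), if_neg h2.ne', sub_self]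

lemma IsThresholdIndicator.isMinimalProjection {β ρ : ℝ} (hβ : 1 < β) (hf : (remSet β).Finite)
    {E : BoundedContinuousFunction (UnitSpace β) ℂ} (h : IsThresholdIndicator β ρ E)
    (hE : E ∈ algebraA β) : IsMinimalProjection β E := by
  obtain ⟨z₀, hz₀⟩ := exists_th_eq hβ hf h.1
  refine ⟨hE, ⟨?_, ?_⟩, ?_, fun F hF hFp hFE => ?_⟩
  · ext z
    change E z * E z = E z
    rw [h.2]
    split_ifs <;> simp
  · ext z
    change star (E z) = E z
    rw [h.2]
    split_ifs <;> simp
  · intro h0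
    have := h.2 z₀
    rw [h0, if_pos hz₀] at this
    exact zero_ne_one this
  · have hidem : F z₀ * F z₀ = F z₀ := congrArg (fun G => G z₀) hFp.isIdempotentElem.eq
    have hFz : ∀ z, F z = if z.th 0 = ρ then F z₀ else 0 := by
      intro z
      have h1 : F z * E z = F z := congrArg (fun G => G z) hFE
      split_ifs with hz
      · exact algebraA_apply_eq hβ hf hF (hz.trans hz₀.symm)
      · rw [← h1, h.2, if_neg hz, mul_zero]
    rcases (IsIdempotentElem.iff_eq_zero_or_one (p := F z₀)).1 hidem with h1 | h1
    · left
      ext z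
      rw [hFz, h1]
      split_ifs <;> rfl
    · right
      ext z
      rw [hFz, h1, h.2]

lemma IsMinimalProjection.exists_threshold {β : ℝ} (hβ : 1 < β) (hf : (remSet β).Finite)
    {E : BoundedContinuousFunction (UnitSpace β) ℂ} (h : IsMinimalProjection β E) :
    ∃ ρ, IsThresholdIndicator β ρ E := by
  obtain ⟨hE, hp, hne, hmin⟩ := h
  obtain ⟨z₀, hz₀⟩ : ∃ z, E z ≠ 0 := by
    by_contra! h
    exact hne (BoundedContinuousFunction.ext h)
  have hone : E z₀ = 1 := by
    have hidem : E z₀ * E z₀ = E z₀ := congrArg (fun G => G z₀) hp.isIdempotentElem.eq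
    exact mul_left_cancel₀ hz₀ (by rw [hidem, mul_one])
  -- A projection that is nonzero at a path dominates the indicator of its threshold, so by
  -- minimality it equals it.
  obtain ⟨F, hF, hFi, -⟩ := exists_thresholdIndicator hβ hf (z₀.th_mem hβ hf 0)
  have hFm := hFi.isMinimalProjection hβ hf hF
  have hFE : F * E = F := by
    ext z
    change F z * E z = F z
    rw [hFi.2]
    split_ifs with hz
    · rw [algebraA_apply_eq hβ hf hE hz, hone, one_mul]
    · rw [zero_mul]
  rcases hmin F hF hFm.2.1 hFE with h | h
  · exact absurd h hFm.2.2.1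
  · exact ⟨_, h ▸ hFi⟩

lemma mem_wordsAbove_iff {β ρ : ℝ} (hβ : 1 < β) (hf : (remSet β).Finite)
    {E : BoundedContinuousFunction (UnitSpace β) ℂ} (h : IsThresholdIndicator β ρ E)
    (ν : List ℕ) : ν ∈ wordsAbove β E ↔ ρ ≤ weight β 1 ν := by
  constructor
  · rintro ⟨-, hν⟩
    obtain ⟨z, hz⟩ := exists_th_eq hβ hf h.1
    have h1 : proj β ν z * E z = E z := congrArg (fun G => G z) hν
    rw [h.2, if_pos hz, mul_one, proj_apply hβ hf, hz] at h1
    by_contra hlt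
    rw [if_neg hlt] at h1
    exact zero_ne_one h1
  · intro hle
    refine ⟨admissible_of_weight_pos hβ ((remSet_pos h.1).trans_le hle), ?_⟩
    ext z
    change proj β ν z * E z = E z
    rw [h.2, proj_apply hβ hf]
    by_cases hz : z.th 0 = ρ
    · rw [if_pos (hz.trans_le hle), one_mul]
    · rw [if_neg hz, mul_zero]

lemma indicator_sub_eq {P Q R : Prop} [Decidable P] [Decidable Q] [Decidable R]
    (h : ((if P then 1 else 0) - (if Q then 1 else 0) : ℂ) = if R then 1 else 0) :
    P ∧ ¬ Q ↔ R := by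
  by_cases h1 : P <;> by_cases h2 : Q <;> by_cases h3 : R <;> simp [h1, h2, h3] at h ⊢
  norm_num [Complex.ext_iff] at h

/-- The indices p and q in the presentation of E are not unique, but evaluating E on every threshold
shows that their remainders are ρ and low ρ. -/
lemma isInterval_iff {β ρ : ℝ} (hβ : 1 < β) (hf : (remSet β).Finite)
    {E : BoundedContinuousFunction (UnitSpace β) ℂ} (h : IsThresholdIndicator β ρ E)
    (hE : E ∈ algebraA β) (ν : List ℕ) (c d : ℝ) : IsInterval β ν E c d ↔
      ρ ≤ weight β 1 ν ∧ c = leftEnd β ν + low β ρ / β ^ ν.length ∧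
        d = leftEnd β ν + ρ / β ^ ν.length := by
  have hone : ∀ {P : Prop} [Decidable P], (if P then (1 : ℂ) else 0) = 1 ↔ P := by simp
  have hval : ∀ σ ∈ remSet β, ∃ z : UnitSpace β, z.th 0 = σ ∧ E z = if σ = ρ then 1 else 0 := by
    intro σ hσ
    obtain ⟨z, rfl⟩ := exists_th_eq hβ hf hσ
    exact ⟨z, rfl, h.2 z⟩
  have hrel : ∀ p, E = proj β (xiWord β p) → qgRem β p = ρ ∧ low β ρ = 0 := by
    rintro p rfl
    have key : ∀ σ ∈ remSet β, σ ≤ qgRem β p ↔ σ = ρ := by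
      intro σ hσ
      obtain ⟨z, hz, hEz⟩ := hval σ hσ
      rw [proj_xiWord_apply hβ hf, hz] at hEz
      by_cases hc : σ = ρ
      · rw [if_pos hc] at hEz
        exact iff_of_true (hone.1 hEz) hc
      · refine iff_of_false (fun hle => ?_) hc
        rw [if_pos hle, if_neg hc] at hEz
        exact one_ne_zero hEz
    refine ⟨(key _ ⟨p, rfl⟩).1 le_rfl, ?_⟩
    rcases (low_spec hf ρ).1 with h1 | ⟨h1, h2⟩
    · exact h1
    · exact absurd ((key _ h1).1 (h2.le.trans ((key _ h.1).2 rfl))) h2.ne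
  have hrel2 : ∀ p q, E = proj β (xiWord β p) - proj β (xiWord β q) →
      qgRem β p = ρ ∧ qgRem β q = low β ρ := by
    rintro p q rfl
    have key : ∀ σ ∈ remSet β, (σ ≤ qgRem β p ∧ qgRem β q < σ) ↔ σ = ρ := by
      intro σ hσ
      obtain ⟨z, hz, hEz⟩ := hval σ hσ
      rw [BoundedContinuousFunction.sub_apply, proj_xiWord_apply hβ hf,
        proj_xiWord_apply hβ hf, hz] at hEz
      rw [← not_le]
      exact indicator_sub_eq hEz
    have h1 := (key _ h.1).2 rfl
    have h2 := (key _ ⟨p, rfl⟩).1 ⟨le_rfl, h1.2.trans_le h1.1⟩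
    refine ⟨h2, (le_low hf ⟨q, rfl⟩ h1.2).antisymm ?_⟩
    rcases (low_spec hf ρ).1 with h3 | ⟨h3, h4⟩
    · rw [h3]
      exact (qgRem_mem q).1.le
    · by_contra! hlt
      exact h4.ne ((key _ h3).1 ⟨h4.le.trans h1.1, hlt⟩)
  constructor
  · rintro ⟨-, hν, p, hd, ⟨q, hE', hc⟩ | ⟨hE', hc⟩⟩
    · obtain ⟨h1, h2⟩ := hrel2 p q hE'
      rw [betaVal_eq_qgRem hβ, h1] at hd
      rw [betaVal_eq_qgRem hβ, h2] at hc
      exact ⟨(mem_wordsAbove_iff hβ hf h ν).1 hν, hc, hd⟩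
    · obtain ⟨h1, h2⟩ := hrel p hE'
      rw [betaVal_eq_qgRem hβ, h1] at hd
      exact ⟨(mem_wordsAbove_iff hβ hf h ν).1 hν, by rw [hc, h2, zero_div, add_zero], hd⟩
  · rintro ⟨hν, hc, hd⟩
    refine ⟨h.isMinimalProjection hβ hf hE, (mem_wordsAbove_iff hβ hf h ν).2 hν, ?_⟩
    obtain ⟨F, -, hF, p, hp, hpq⟩ := exists_thresholdIndicator hβ hf h.1
    have hFE : E = F := by
      ext z
      rw [h.2, hF.2]
    refine ⟨p, by rw [betaVal_eq_qgRem hβ, hp, hd], ?_⟩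
    rcases hpq with ⟨q, hq, hF'⟩ | ⟨h0, hF'⟩
    · exact Or.inl ⟨q, hFE.trans hF', by rw [betaVal_eq_qgRem hβ, hq, hc]⟩
    · exact Or.inr ⟨hFE.trans hF', by rw [hc, h0, zero_div, add_zero]⟩

/-- The condition on the ratio is automatic: both sides are scaled copies of [low ρ, ρ). -/
lemma isRectangle_iff {β : ℝ} (hβ : 1 < β) (hf : (remSet β).Finite) {c d c' d' : ℝ} :
    IsRectangle β c d c' d' ↔ ∃ (ν μ : List ℕ) (ρ : ℝ), ρ ∈ remSet β ∧ ρ ≤ weight β 1 ν ∧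
      ρ ≤ weight β 1 μ ∧ c = leftEnd β ν + low β ρ / β ^ ν.length ∧
      d = leftEnd β ν + ρ / β ^ ν.length ∧ c' = leftEnd β μ + low β ρ / β ^ μ.length ∧
      d' = leftEnd β μ + ρ / β ^ μ.length := by
  have hb : (0 : ℝ) < β := by linarith
  constructor
  · rintro ⟨ν, μ, E, h1, h2, -⟩
    obtain ⟨ρ, hρ⟩ := h1.1.exists_threshold hβ hf
    obtain ⟨a1, a2, a3⟩ := (isInterval_iff hβ hf hρ h1.1.1 ν c d).1 h1
    obtain ⟨b1, b2, b3⟩ := (isInterval_iff hβ hf hρ h1.1.1 μ c' d').1 h2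
    exact ⟨ν, μ, ρ, hρ.1, a1, b1, a2, a3, b2, b3⟩
  · rintro ⟨ν, μ, ρ, hρ, a1, b1, a2, a3, b2, b3⟩
    obtain ⟨E, hE, hρE, -⟩ := exists_thresholdIndicator hβ hf hρ
    refine ⟨ν, μ, E, (isInterval_iff hβ hf hρE hE ν c d).2 ⟨a1, a2, a3⟩,
      (isInterval_iff hβ hf hρE hE μ c' d').2 ⟨b1, b2, b3⟩, ?_⟩
    have h1 := sub_pos.2 (low_lt hf (remSet_pos hρ))
    have e1 : d - c = (ρ - low β ρ) / β ^ ν.length := by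
      rw [a2, a3, sub_div]
      ring
    have e2 : d' - c' = (ρ - low β ρ) / β ^ μ.length := by
      rw [b2, b3, sub_div]
      ring
    rw [e1, e2, zpow_sub₀ hb.ne', zpow_natCast, zpow_natCast]
    field_simp

/-! ### Families of intervals -/

lemma exists_partition {ι : Type*} [Finite ι] {a b : ι → ℝ} (hab : ∀ i, a i < b i)
    (hsub : ∀ i, 0 ≤ a i ∧ b i ≤ 1)
    (hex : ∀ t : ℝ, 0 ≤ t → t < 1 → ∃ i, a i ≤ t ∧ t < b i)
    (hun : ∀ (t : ℝ) (i j : ι), a i ≤ t → t < b i → a j ≤ t → t < b j → i = j) :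
    ∃ (m : ℕ) (e : Fin m ≃ ι) (x : Fin (m + 1) → ℝ), IsPartition x ∧
      ∀ p, x p.castSucc = a (e p) ∧ x p.succ = b (e p) := by
  classical
  have := Fintype.ofFinite ι
  have hinj : Function.Injective a := fun i j hij =>
    hun (a i) i j le_rfl (hab i) hij.ge (hij ▸ hab j)
  -- The intervals are ordered by their left ends, which are distinct. Covering and disjointness
  -- make each right end the next left end, or 1 for the last interval.
  let _ : LinearOrder ι := LinearOrder.lift' a hinj
  let e := monoEquivOfFin ι (rfl : Fintype.card ι = _)
  have hmono : ∀ p q, p ≤ q → a (e p) ≤ a (e q) := fun p q h => e.monotone h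
  have hstrict : ∀ p q, p < q → a (e p) < a (e q) := fun p q h => e.strictMono h
  have hlater : ∀ i j, a j ≤ b i → b i < b j → a i < a j := by
    intro i j h1 h2
    by_contra! h3
    have := hun (a i) i j le_rfl (hab i) h3 ((hab i).trans h2)
    rw [this] at h2
    exact h2.false
  let x : Fin (Fintype.card ι + 1) → ℝ := Fin.snoc (fun p => a (e p)) 1
  have hx : ∀ p, x (Fin.castSucc p) = a (e p) := fun p => by simp [x]
  have hxl : x (Fin.last _) = 1 := by simp [x]
  have hnext : ∀ p, x (Fin.succ p) = b (e p) := by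
    intro p
    rcases Fin.eq_castSucc_or_eq_last p.succ with ⟨q, hq⟩ | hq
    · rw [hq, hx]
      have hpq : p < q := by
        rw [← Fin.castSucc_lt_castSucc_iff, ← hq]
        exact Fin.castSucc_lt_succ
      have h1 : b (e p) ≤ a (e q) := by
        by_contra! h
        have := e.injective (hun (a (e q)) _ _ (hmono p q hpq.le) h le_rfl (hab (e q)))
        exact hpq.ne this
      have h2 : b (e p) < 1 := h1.trans_lt ((hab _).trans_le (hsub _).2)
      obtain ⟨j, hj1, hj2⟩ := hex (b (e p)) ((hsub _).1.trans (hab _).le) h2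
      have h3 := hlater _ _ hj1 hj2
      obtain ⟨r, rfl⟩ := e.surjective j
      have hpr : p < r := by
        by_contra! hrp
        exact absurd h3 (not_lt.2 (hmono r p hrp))
      have hqr : q ≤ r := by
        rw [← Fin.castSucc_le_castSucc_iff, ← hq]
        exact Fin.succ_le_castSucc_iff.2 hpr
      exact le_antisymm ((hmono q r hqr).trans hj1) h1
    · rw [hq, hxl]
      by_contra hne
      have h2 : b (e p) < 1 := lt_of_le_of_ne (hsub _).2 (Ne.symm hne)
      obtain ⟨j, hj1, hj2⟩ := hex (b (e p)) ((hsub _).1.trans (hab _).le) h2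
      have h3 := hlater _ _ hj1 hj2
      obtain ⟨r, rfl⟩ := e.surjective j
      have hrp : r ≤ p := by
        rw [← Fin.castSucc_lt_succ_iff, hq]
        exact Fin.castSucc_lt_last r
      exact absurd h3 (not_lt.2 (hmono r p hrp))
  refine ⟨_, e.toEquiv, x, ⟨?_, ?_, hxl⟩, fun p => ⟨hx p, hnext p⟩⟩
  · refine Fin.strictMono_iff_lt_succ.2 fun p => ?_
    rw [hx, hnext]
    exact hab _
  · obtain ⟨j, hj1, -⟩ := hex 0 le_rfl one_pos
    obtain ⟨r, rfl⟩ := e.surjective j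
    have hm : Monotone x := (Fin.strictMono_iff_lt_succ.2 fun p => by
      rw [hx, hnext]; exact hab _).monotone
    refine le_antisymm ((hm (Fin.zero_le r.castSucc)).trans ((hx r).trans_le hj1)) ?_
    rcases Fin.eq_castSucc_or_eq_last (0 : Fin (Fintype.card ι + 1)) with ⟨q, hq⟩ | hq
    · rw [hq, hx]
      exact (hsub _).1
    · rw [hq, hxl]
      exact zero_le_one

namespace UnitSpace

variable {β : ℝ}

/-! ### From the full group to PL functions -/

lemma agree_iff_cylinder (hβ : 1 < β) (hf : (remSet β).Finite) {m : ℕ} {z z' : UnitSpace β} :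
    Agree m z z' ↔ (pre z.lab m, z.th m) = (pre z'.lab m, z'.th m) := by
  rw [Prod.mk.injEq, pre_eq_iff]
  exact ⟨fun h => ⟨h.1, h.th_eq⟩, fun h => ⟨h.1, ver_congr hβ hf h.2⟩⟩

lemma lsum_nonneg (hβ : 1 < β) (z : UnitSpace β) (n : ℕ) : 0 ≤ z.lsum n :=
  Finset.sum_nonneg fun _ _ => div_nonneg (Nat.cast_nonneg _) (pow_nonneg (by linarith) _)

/-- Left end of the interval of the cylinder of `z` at level `n`. -/
def leftPt (z : UnitSpace β) (n : ℕ) : ℝ := z.lsum n + low β (z.th n) / β ^ n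

/-- Right end of the interval of the cylinder of `z` at level `n`. -/
def rightPt (z : UnitSpace β) (n : ℕ) : ℝ := z.lsum n + z.th n / β ^ n

lemma leftPt_lt_rightPt (hβ : 1 < β) (hf : (remSet β).Finite) (z : UnitSpace β) (n : ℕ) :
    z.leftPt n < z.rightPt n := by
  have hb : (0 : ℝ) < β := by linarith
  have := low_lt hf (remSet_pos (z.th_mem hβ hf n))
  unfold leftPt rightPt
  gcongr

lemma leftPt_nonneg (hβ : 1 < β) (hf : (remSet β).Finite) (z : UnitSpace β) (n : ℕ) :
    0 ≤ z.leftPt n :=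
  add_nonneg (z.lsum_nonneg hβ n) (div_nonneg (low_nonneg hf _) (pow_nonneg (by linarith) _))

lemma rightPt_le_one (hβ : 1 < β) (hf : (remSet β).Finite) (z : UnitSpace β) (n : ℕ) :
    z.rightPt n ≤ 1 :=
  (z.lsum_add_th_le hβ hf n).trans (remSet_le_one (z.th_mem hβ hf 0))

lemma th_le_weight_pre (hβ : 1 < β) (hf : (remSet β).Finite) (z : UnitSpace β) (n : ℕ) :
    z.th n ≤ weight β 1 (pre z.lab n) :=
  (ver_eq_true_iff hβ hf z n _).1 (z.ver_pre_true n)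

lemma isRectangle_cylinders (hβ : 1 < β) (hf : (remSet β).Finite) {z w : UnitSpace β} {n k : ℕ}
    (h : z.th n = w.th k) :
    IsRectangle β (z.leftPt n) (z.rightPt n) (w.leftPt k) (w.rightPt k) := by
  refine (isRectangle_iff hβ hf).2 ⟨pre z.lab n, pre w.lab k, z.th n, z.th_mem hβ hf n,
    z.th_le_weight_pre hβ hf n, h ▸ w.th_le_weight_pre hβ hf k, ?_⟩
  rw [leftEnd_pre, leftEnd_pre, pre_length, pre_length]
  exact ⟨rfl, rfl, by rw [h]; rfl, by rw [h]; rfl⟩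

/-- Replacing prefixes is an affine map. -/
lemma coding_eq_affine (hβ : 1 < β) (hf : (remSet β).Finite) {z w z' w' : UnitSpace β} {n k : ℕ}
    (h : z.th n = w.th k) (hz : ∀ i < n, z'.lab i = z.lab i) (hw : ∀ i < k, w'.lab i = w.lab i)
    (he : (shiftMap β)^[k] w' = (shiftMap β)^[n] z') :
    coding w' = w.leftPt k + (w.rightPt k - w.leftPt k) / (z.rightPt n - z.leftPt n) *
      (coding z' - z.leftPt n) := by
  have hb : (0 : ℝ) < β := by linarith
  have h1 := coding_eq hβ hf z' n
  have h2 := coding_eq hβ hf w' k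
  have h3 : z'.lsum n = z.lsum n :=
    Finset.sum_congr rfl fun i hi => by rw [hz i (Finset.mem_range.1 hi)]
  have h4 : w'.lsum k = w.lsum k :=
    Finset.sum_congr rfl fun i hi => by rw [hw i (Finset.mem_range.1 hi)]
  have h5 : z.th n - low β (z.th n) ≠ 0 :=
    (sub_pos.2 (low_lt hf (remSet_pos (z.th_mem hβ hf n)))).ne'
  rw [h2, he, h4, h1, h3, leftPt, rightPt, leftPt, rightPt, ← h]
  have e1 : w.lsum k + z.th n / β ^ k - (w.lsum k + low β (z.th n) / β ^ k) =
    (z.th n - low β (z.th n)) / β ^ k := by ring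
  have e2 : z.lsum n + z.th n / β ^ n - (z.lsum n + low β (z.th n) / β ^ n) =
    (z.th n - low β (z.th n)) / β ^ n := by ring
  rw [e1, e2]
  field_simp
  ring

lemma isBetaAdicPL_realize (hβ : 1 < β) (hf : (remSet β).Finite) (τ : fullGroup β) :
    IsBetaAdicPL β (realize hβ hf τ) := by
  obtain ⟨m, hm⟩ := exists_uniform_orbital hβ hf τ.2
  choose K hK using hm
  let ι := Set.range fun z : UnitSpace β => (pre z.lab m, z.th m)
  have : Finite ι := finite_range_cylinder hβ hf m
  choose Z hZ using fun i : ι => i.2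
  have hcyl : ∀ (i : ι) (z : UnitSpace β), Agree m z (Z i) ↔ (pre z.lab m, z.th m) = i.1 := by
    intro i z
    rw [agree_iff_cylinder hβ hf]
    exact Eq.congr_right (hZ i)
  have hth : ∀ z, z.th m = (τ.1 z).th (K z) := by
    intro z
    have h := congrArg (fun w => w.th 0) (hK z z (Agree.refl m z)).2
    simp only [th_iterate, add_zero] at h
    exact h.symm
  -- The image of a whole cylinder is a whole cylinder. For the inclusion that is not immediate, the
  -- prefix of z is put in front of the tail of `τ w`; the image of the new path must be `τ w`.
  have himg : ∀ z w, Agree (K z) (τ.1 w) (τ.1 z) ↔ Agree m w z := by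
    intro z w
    constructor
    · intro h
      have hv : ((shiftMap β)^[K z] (τ.1 w)).ver 0 = z.ver m := by
        rw [ver_iterate, add_zero, h.2]
        exact (ver_congr hβ hf (hth z)).symm
      obtain ⟨w', h1, h2⟩ := exists_prepend hβ hf (pre z.lab m) (hv ▸ z.ver_pre_true m)
      rw [pre_length] at h1 h2
      have ha : Agree m w' z := by
        refine ⟨pre_eq_iff.1 h1, ?_⟩
        rw [← hv, ← h2, ver_iterate, add_zero]
      obtain ⟨h3, h4⟩ := hK z w' ha
      have : τ.1 w' = τ.1 w :=
        eq_of_iterate (fun i hi => (h3 i hi).trans (h.1 i hi).symm) (h4.trans h2)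
      rwa [← τ.1.injective this]
    · intro h
      obtain ⟨h3, h4⟩ := hK z w h
      refine ⟨h3, ver_congr hβ hf ?_⟩
      have h5 := congrArg (fun w => w.th 0) h4
      simp only [th_iterate, add_zero] at h5
      rw [h5, ← hth, h.th_eq]
  have hdom : ∀ (i : ι) (t : Set.Ico (0 : ℝ) 1), (Z i).leftPt m ≤ t ∧ (t : ℝ) < (Z i).rightPt m ↔
      (pre (lift hβ hf t).lab m, (lift hβ hf t).th m) = i.1 := fun i t => by
    rw [← hcyl]
    exact (agree_lift_iff hβ hf (Z i) m t).symm
  have hcod : ∀ (i : ι) (t : Set.Ico (0 : ℝ) 1),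
      (τ.1 (Z i)).leftPt (K (Z i)) ≤ realize hβ hf τ t ∧
        (realize hβ hf τ t : ℝ) < (τ.1 (Z i)).rightPt (K (Z i)) ↔
      (pre (lift hβ hf t).lab m, (lift hβ hf t).th m) = i.1 := fun i t => by
    rw [← hcyl, ← himg, ← lift_realize hβ hf]
    exact (agree_lift_iff hβ hf _ _ _).symm
  obtain ⟨N, e, x, hx, hxe⟩ := exists_partition (ι := ι)
    (fun i => leftPt_lt_rightPt hβ hf (Z i) m)
    (fun i => ⟨leftPt_nonneg hβ hf (Z i) m, rightPt_le_one hβ hf (Z i) m⟩)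
    (fun t h0 h1 => ⟨⟨_, lift hβ hf ⟨t, h0, h1⟩, rfl⟩, (hdom _ ⟨t, h0, h1⟩).2 rfl⟩)
    (fun t i j h1 h2 h3 h4 => by
      have ht : t ∈ Set.Ico (0 : ℝ) 1 :=
        ⟨(leftPt_nonneg hβ hf _ _).trans h1, h2.trans_le (rightPt_le_one hβ hf _ _)⟩
      exact Subtype.ext (((hdom i ⟨t, ht⟩).1 ⟨h1, h2⟩).symm.trans ((hdom j ⟨t, ht⟩).1 ⟨h3, h4⟩)))
  obtain ⟨N', e', y, hy, hye⟩ := exists_partition (ι := ι)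
    (fun i => leftPt_lt_rightPt hβ hf (τ.1 (Z i)) (K (Z i)))
    (fun i => ⟨leftPt_nonneg hβ hf (τ.1 (Z i)) (K (Z i)),
      rightPt_le_one hβ hf (τ.1 (Z i)) (K (Z i))⟩)
    (fun t h0 h1 => by
      obtain ⟨t', ht'⟩ := (realize hβ hf τ).surjective ⟨t, h0, h1⟩
      refine ⟨⟨_, lift hβ hf t', rfl⟩, ?_⟩
      have := (hcod ⟨_, lift hβ hf t', rfl⟩ t').2 rfl
      rwa [ht'] at this)
    (fun t i j h1 h2 h3 h4 => by
      have ht : t ∈ Set.Ico (0 : ℝ) 1 :=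
        ⟨(leftPt_nonneg hβ hf _ _).trans h1, h2.trans_le (rightPt_le_one hβ hf _ _)⟩
      obtain ⟨t', ht'⟩ := (realize hβ hf τ).surjective ⟨t, ht⟩
      have ht'' : (realize hβ hf τ t' : ℝ) = t := congrArg Subtype.val ht'
      have a1 := hcod i t'
      have a2 := hcod j t'
      rw [ht''] at a1 a2
      exact Subtype.ext ((a1.1 ⟨h1, h2⟩).symm.trans (a2.1 ⟨h3, h4⟩)))
  -- Both partitions are indexed by the same set of cylinders, and the permutation passes through
  -- it.
  obtain rfl : N = N' := Fin.equiv_iff_eq.1 ⟨e.trans e'.symm⟩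
  have hπ : ∀ p, y ((e.trans e'.symm) p).castSucc = (τ.1 (Z (e p))).leftPt (K (Z (e p))) ∧
      y ((e.trans e'.symm) p).succ = (τ.1 (Z (e p))).rightPt (K (Z (e p))) := fun p => by
    have := hye ((e.trans e'.symm) p)
    simpa using this
  refine ⟨N, x, y, e.trans e'.symm, ⟨hx, hy, fun p => ?_⟩, fun p t h1 h2 => ?_⟩
  · rw [(hπ p).1, (hπ p).2, (hxe p).1, (hxe p).2]
    exact isRectangle_cylinders hβ hf (hth _)
  · rw [(hπ p).1, (hπ p).2, (hxe p).1, (hxe p).2]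
    rw [(hxe p).1] at h1
    rw [(hxe p).2] at h2
    have ha := (agree_lift_iff hβ hf (Z (e p)) m t).2 ⟨h1, h2⟩
    obtain ⟨h3, h4⟩ := hK _ _ ha
    have := coding_eq_affine hβ hf (hth (Z (e p))) ha.1 h3 h4
    rwa [coding_lift] at this

/-! ### From PL functions to the full group -/

/-- Equality of the terminal vertices allows the tail to be attached to the new prefix. Agreement on
n + N edges becomes agreement on k + N edges, which gives continuity. -/
lemma exists_prefix_exchange (hβ : 1 < β) (hf : (remSet β).Finite) {ι : Type*}
    {A B : ι → UnitSpace β} {n k : ι → ℕ} (hv : ∀ i, (A i).ver (n i) = (B i).ver (k i))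
    (hA : ∀ z, ∃! i, Agree (n i) z (A i)) :
    ∃ T : UnitSpace β → UnitSpace β, Continuous T ∧ ∀ i z, Agree (n i) z (A i) →
      Agree (k i) (T z) (B i) ∧ (shiftMap β)^[k i] (T z) = (shiftMap β)^[n i] z := by
  have hex : ∀ z, ∃ w, ∀ i, Agree (n i) z (A i) →
      Agree (k i) w (B i) ∧ (shiftMap β)^[k i] w = (shiftMap β)^[n i] z := by
    intro z
    obtain ⟨i, hi, hun⟩ := hA z
    have h : ((shiftMap β)^[n i] z).ver 0 = (B i).ver (k i) := by
      rw [ver_iterate, add_zero, hi.2, hv]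
    obtain ⟨w, h1, h2⟩ := exists_prepend hβ hf (pre (B i).lab (k i)) (h ▸ (B i).ver_pre_true (k i))
    rw [pre_length] at h1 h2
    refine ⟨w, fun j hj => ?_⟩
    rw [hun j hj]
    refine ⟨⟨pre_eq_iff.1 h1, ?_⟩, h2⟩
    rw [← h, ← h2, ver_iterate, add_zero]
  choose T hT using hex
  refine ⟨T, continuous_iff_continuousAt.2 fun z V hV => ?_, fun i z h => hT z i h⟩
  obtain ⟨N, hN⟩ := exists_agree_subset hV
  obtain ⟨i, hi, -⟩ := hA z
  obtain ⟨h1, h2⟩ := hT z i hi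
  rw [mem_map]
  filter_upwards [agree_eventually hβ hf z (n i + N)] with z' hz'
  obtain ⟨h3, h4⟩ := hT z' i ((hz'.mono (Nat.le_add_right _ _)).trans hi)
  refine hN _ (Agree.mono (Nat.le_add_left N (k i))
    (Agree.of_iterate (h3.trans h1.symm).1 ?_))
  rw [h4, h2]
  exact hz'.iterate

lemma exists_orbital (hβ : 1 < β) (hf : (remSet β).Finite) {ι : Type*}
    {A B : ι → UnitSpace β} {n k : ι → ℕ} (hv : ∀ i, (A i).ver (n i) = (B i).ver (k i))
    (hA : ∀ z, ∃! i, Agree (n i) z (A i)) (hB : ∀ z, ∃! i, Agree (k i) z (B i)) :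
    ∃ τ : UnitSpace β ≃ₜ UnitSpace β, IsLocallyOrbital (shiftMap β) τ ∧
      ∀ i z, Agree (n i) z (A i) →
        Agree (k i) (τ z) (B i) ∧ (shiftMap β)^[k i] (τ z) = (shiftMap β)^[n i] z := by
  have hinv : ∀ {A B : ι → UnitSpace β} {n k : ι → ℕ} {T T' : UnitSpace β → UnitSpace β},
      (∀ z, ∃! i, Agree (n i) z (A i)) →
      (∀ i z, Agree (n i) z (A i) →
        Agree (k i) (T z) (B i) ∧ (shiftMap β)^[k i] (T z) = (shiftMap β)^[n i] z) →
      (∀ i z, Agree (k i) z (B i) →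
        Agree (n i) (T' z) (A i) ∧ (shiftMap β)^[n i] (T' z) = (shiftMap β)^[k i] z) →
      Function.LeftInverse T' T := by
    intro A B n k T T' hA hT hT' z
    obtain ⟨i, hi, -⟩ := hA z
    obtain ⟨h1, h2⟩ := hT i z hi
    obtain ⟨h3, h4⟩ := hT' i _ h1
    exact eq_of_iterate (h3.trans hi.symm).1 (h4.trans h2)
  obtain ⟨T, hTc, hT⟩ := exists_prefix_exchange hβ hf hv hA
  obtain ⟨T', hTc', hT'⟩ := exists_prefix_exchange hβ hf (fun i => (hv i).symm) hB
  refine ⟨⟨⟨T, T', hinv hA hT hT', hinv hB hT' hT⟩, hTc, hTc'⟩, fun z => ?_, hT⟩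
  obtain ⟨i, hi, -⟩ := hA z
  refine ⟨k i, n i, ?_⟩
  filter_upwards [agree_eventually hβ hf z (n i)] with z' hz'
  exact (hT i z' (hz'.trans hi)).2

/-- A partition into cylinders can be tested on the dense set of lifts: the finite union is closed,
and overlaps are open, so a nonempty one contains a lift. -/
lemma existsUnique_agree (hβ : 1 < β) (hf : (remSet β).Finite) {ι : Type*} [Finite ι]
    {A : ι → UnitSpace β} {n : ι → ℕ} (h : ∀ t, ∃! i, Agree (n i) (lift hβ hf t) (A i))
    (z : UnitSpace β) : ∃! i, Agree (n i) z (A i) := by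
  have hc : IsClosed (⋃ i, {z | Agree (n i) z (A i)}) :=
    isClosed_iUnion_of_finite fun i => isClosed_agree hβ hf (n i) (A i)
  have hz : z ∈ ⋃ i, {z | Agree (n i) z (A i)} := by
    refine closure_minimal ?_ hc (dense_range_lift hβ hf z)
    rintro _ ⟨t, rfl⟩
    obtain ⟨i, hi, -⟩ := h t
    exact Set.mem_iUnion.2 ⟨i, hi⟩
  obtain ⟨i, hi⟩ := Set.mem_iUnion.1 hz
  refine ⟨i, hi, fun j hj => ?_⟩
  obtain ⟨_, ⟨hwi, hwj⟩, t, rfl⟩ := (dense_range_lift hβ hf).inter_open_nonempty _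
    ((isOpen_agree hβ hf (n i) (A i)).inter (isOpen_agree hβ hf (n j) (A j))) ⟨z, hi, hj⟩
  exact (h t).unique hwj hwi

lemma exists_cylinder (hβ : 1 < β) (hf : (remSet β).Finite) {ν : List ℕ} {ρ : ℝ}
    (hρ : ρ ∈ remSet β) (h : ρ ≤ weight β 1 ν) :
    ∃ z : UnitSpace β, z.th ν.length = ρ ∧ z.lsum ν.length = leftEnd β ν := by
  obtain ⟨w, hw⟩ := exists_th_eq hβ hf hρ
  obtain ⟨z, h1, h2⟩ := exists_prepend hβ hf ν ((ver_eq_true_iff hβ hf w 0 ν).2 (hw ▸ h))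
  refine ⟨z, ?_, by rw [← leftEnd_pre, h1]⟩
  rw [← hw, ← h2, th_iterate, add_zero]

end UnitSpace

/-! ### β-adic patterns of squares as prefix exchanges -/

lemma IsRectangle.exists_cylinders {β : ℝ} (hβ : 1 < β) (hf : (remSet β).Finite) {c d c' d' : ℝ}
    (h : IsRectangle β c d c' d') : ∃ (z w : UnitSpace β) (n k : ℕ), z.th n = w.th k ∧
      c = z.leftPt n ∧ d = z.rightPt n ∧ c' = w.leftPt k ∧ d' = w.rightPt k := by
  obtain ⟨ν, μ, ρ, hρ, h1, h2, rfl, rfl, rfl, rfl⟩ := (isRectangle_iff hβ hf).1 h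
  obtain ⟨z, hz1, hz2⟩ := UnitSpace.exists_cylinder hβ hf hρ h1
  obtain ⟨w, hw1, hw2⟩ := UnitSpace.exists_cylinder hβ hf hρ h2
  refine ⟨z, w, ν.length, μ.length, hz1.trans hw1.symm, ?_⟩
  rw [UnitSpace.leftPt, UnitSpace.rightPt, UnitSpace.leftPt, UnitSpace.rightPt, hz1, hz2, hw1, hw2]
  exact ⟨rfl, rfl, rfl, rfl⟩

lemma IsPartition.existsUnique {m : ℕ} {x : Fin (m + 1) → ℝ} (hx : IsPartition x)
    (t : Set.Ico (0 : ℝ) 1) : ∃! p : Fin m, x p.castSucc ≤ t ∧ (t : ℝ) < x p.succ := by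
  obtain ⟨hmono, h0, h1⟩ := hx
  have hex : ∃ p : Fin m, x p.castSucc ≤ t ∧ (t : ℝ) < x p.succ := by
    by_contra! hno
    have hle : ∀ q, x q ≤ t := fun q => by
      induction q using Fin.induction with
      | zero =>
        rw [h0]
        exact t.2.1
      | succ p ih => exact hno p ih
    have hlast := hle (Fin.last m)
    rw [h1] at hlast
    exact absurd hlast (not_le.2 t.2.2)
  have hun : ∀ p q : Fin m, p < q → (t : ℝ) < x p.succ → ¬ x q.castSucc ≤ t := fun p q hpq h =>
    not_le.2 (h.trans_le (hmono.monotone (Fin.succ_le_castSucc_iff.2 hpq)))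
  obtain ⟨p, hp⟩ := hex
  refine ⟨p, hp, fun q hq => ?_⟩
  rcases lt_trichotomy p q with h | h | h
  · exact absurd hq.1 (hun p q h hp.2)
  · exact h.symm
  · exact absurd hp.1 (hun q p h hq.2)

lemma exists_realize_eq {β : ℝ} (hβ : 1 < β) (hf : (remSet β).Finite)
    {f : Equiv.Perm (Set.Ico (0 : ℝ) 1)} (h : IsBetaAdicPL β f) :
    ∃ τ, realize hβ hf τ = f := by
  obtain ⟨m, x, y, π, ⟨hx, hy, hrect⟩, hfx⟩ := h
  choose A B n k hth hA1 hA2 hB1 hB2 using fun p => (hrect p).exists_cylinders hβ hf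
  have hA : ∀ z, ∃! p, Agree (n p) z (A p) := by
    refine existsUnique_agree hβ hf fun t => ?_
    have := hx.existsUnique t
    simp only [hA1, hA2] at this
    simpa only [agree_lift_iff, leftPt, rightPt] using this
  have hB : ∀ z, ∃! p, Agree (k p) z (B p) := by
    refine existsUnique_agree hβ hf fun t => ?_
    have h1 : ∃! p, y (π p).castSucc ≤ t ∧ (t : ℝ) < y (π p).succ := by
      obtain ⟨q, hq, hun⟩ := hy.existsUnique t
      refine ⟨π.symm q, by simpa using hq, fun p hp => ?_⟩
      rw [← hun (π p) hp, π.symm_apply_apply]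
    simp only [hB1, hB2] at h1
    simpa only [agree_lift_iff, leftPt, rightPt] using h1
  obtain ⟨τ, hτ, hτ'⟩ := exists_orbital hβ hf (fun p => ver_congr hβ hf (hth p)) hA hB
  refine ⟨⟨τ, hτ⟩, Equiv.ext fun t => Subtype.ext ?_⟩
  obtain ⟨p, hp, -⟩ := hx.existsUnique t
  have ha : Agree (n p) (lift hβ hf t) (A p) := by
    rw [agree_lift_iff, ← leftPt, ← rightPt, ← hA1, ← hA2]
    exact hp
  obtain ⟨h1, h2⟩ := hτ' p _ ha
  rw [hfx p t hp.1 hp.2, hA1, hA2, hB1, hB2, realize_apply,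
    coding_eq_affine hβ hf (hth p) ha.1 h1.1 h2, coding_lift]

end

end BetaPL

theorem mainTheorem6 (β : ℝ) (hβ : 1 < β) (hsofic : BetaPL.IsSofic (BetaPL.betaShift β)) :
    ∃ (Γ : Subgroup (BetaPL.UnitSpace β ≃ₜ BetaPL.UnitSpace β))
      (P : Subgroup (Equiv.Perm (Set.Ico (0 : ℝ) 1))),
      (Γ : Set (BetaPL.UnitSpace β ≃ₜ BetaPL.UnitSpace β)) =
          BetaPL.topologicalFullGroup (BetaPL.shiftMap β) ∧
        (P : Set (Equiv.Perm (Set.Ico (0 : ℝ) 1))) = {f | BetaPL.IsBetaAdicPL β f} ∧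
        ∃ Φ : Γ ≃* P, ∀ τ : Γ,
          {z : BetaPL.UnitSpace β | ¬ ∃ t : Set.Ico (0 : ℝ) 1,
            (t : ℝ) = BetaPL.coding z ∧
            (((Φ τ : Equiv.Perm (Set.Ico (0 : ℝ) 1)) t : Set.Ico (0 : ℝ) 1) : ℝ) =
              BetaPL.coding ((τ : BetaPL.UnitSpace β ≃ₜ BetaPL.UnitSpace β) z)}.Finite := by
  have hf := BetaPL.remSet_finite hβ hsofic
  -- Since the PL functions are the range of a homomorphism, they form a group without any
  -- computation with patterns of squares.
  refine ⟨BetaPL.fullGroup β, (BetaPL.realize hβ hf).range, ?_, ?_,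
    MonoidHom.ofInjective (BetaPL.realize_injective hβ hf), BetaPL.exceptional_finite hβ hf⟩
  · ext τ
    exact (BetaPL.UnitSpace.mem_topologicalFullGroup_iff hβ hf).symm
  · ext f
    constructor
    · rintro ⟨τ, rfl⟩
      exact BetaPL.UnitSpace.isBetaAdicPL_realize hβ hf τ
    · exact BetaPL.exists_realize_eq hβ hf
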